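/- For every integer $n \ge 0$ there is a constant $C_n$, depending only on $n$, such that the following holds. Let $(M^n,g)$ be a closed (compact, without boundary) smooth Riemannian manifold of dimension $n$ with Riemannian volume measure $dV$, let $\theta$ be a closed smooth real one-form on $M$, and let $X$ be the vector field dual to $\theta$, i.e. $g(X,Y)=\theta(Y)$ for all $Y$. Let $d_\theta\alpha = d\alpha+\theta\wedge\alpha$ on smooth real forms, let $d_\theta^*$ be the formal $L^2$ adjoint of $d_\theta$ with respect to $g$, and let $\Delta_\theta = d_\theta d_\theta^*+d_\theta^*d_\theta$. Then for every $p \ge 0$ and every smooth real $p$-form $\alpha$ with $\Delta_\theta\alpha=0$, $$\int_M |X|^2|\alpha|^2\,dV \;\le\; C_n\int_M \bigl(|\nabla X|+|\operatorname{div} X|\bigr)|\alpha|^2\,dV ,$$ where $\nabla$ is the Levi-Civita connection of $g$, $|\nabla X|$ is the Hilbert-Schmidt norm of $\nabla X$, $\operatorname{div}X=\operatorname{Tr}\nabla X$ is the divergence, and $|\alpha|$ is the pointwise norm on $p$-forms induced by $g$. -/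

import Mathlib

open scoped Manifold ContDiff

noncomputable section

namespace MorseNovikov

/-- A smooth Riemannian metric on the `n`-manifold `M`. -/
abbrev Metric (n : ℕ) (M : Type*) [TopologicalSpace M] [ChartedSpace (EuclideanSpace ℝ (Fin n)) M]
    [IsManifold (𝓡 n) ∞ M] :=
  Bundle.ContMDiffRiemannianMetric (𝓡 n) ∞ (EuclideanSpace ℝ (Fin n))
    (fun x : M => TangentSpace (𝓡 n) x)

/-- A (not necessarily smooth) real `p`-form on `M`: an alternating `p`-linear form on every tangent
space. -/
abbrev Form (n : ℕ) (M : Type*) [TopologicalSpace M] [ChartedSpace (EuclideanSpace ℝ (Fin n)) M]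
    (p : ℕ) :=
  (x : M) → (TangentSpace (𝓡 n) x) [⋀^Fin p]→L[ℝ] ℝ

section Charts

variable {n : ℕ} {M : Type*} [TopologicalSpace M] [ChartedSpace (EuclideanSpace ℝ (Fin n)) M]

/-- The `i`-th standard basis vector of `ℝⁿ`. -/
def stdVec (i : Fin n) : EuclideanSpace ℝ (Fin n) := EuclideanSpace.single i 1

/-- The derivative `ℝⁿ → T M` at `y` of the inverse of the chart `φ` around `x₀`. -/
def chartSymmDeriv (x₀ : M) (y : EuclideanSpace ℝ (Fin n)) :
    EuclideanSpace ℝ (Fin n) →L[ℝ] TangentSpace (𝓡 n) ((extChartAt (𝓡 n) x₀).symm y) :=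
  mfderiv (𝓡 n) (𝓡 n) (extChartAt (𝓡 n) x₀).symm y

/-- The derivative `T_x M → ℝⁿ` at `x` of the chart `φ` around `x₀`. -/
def chartDeriv (x₀ x : M) : TangentSpace (𝓡 n) x →L[ℝ] EuclideanSpace ℝ (Fin n) :=
  mfderiv (𝓡 n) (𝓡 n) (extChartAt (𝓡 n) x₀) x

/-- The expression `(φ⁻¹)^* σ` of a `p`-form in the chart `φ` around `x₀`. -/
def formRep {p : ℕ} (σ : Form n M p) (x₀ : M) (y : EuclideanSpace ℝ (Fin n)) :
    (EuclideanSpace ℝ (Fin n)) [⋀^Fin p]→L[ℝ] ℝ :=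
  (σ ((extChartAt (𝓡 n) x₀).symm y)).compContinuousLinearMap (chartSymmDeriv x₀ y)

/-- A form is smooth if its expressions in the charts are smooth. -/
def IsSmooth {p : ℕ} (σ : Form n M p) : Prop :=
  ∀ x₀ : M, ContDiffOn ℝ ∞ (formRep σ x₀) (extChartAt (𝓡 n) x₀).target

/-- The exterior derivative, computed at `x` in the chart around `x`. -/
def extDer {p : ℕ} (σ : Form n M p) : Form n M (p + 1) := fun x =>
  (extDeriv (formRep σ x) (extChartAt (𝓡 n) x x)).compContinuousLinearMap (chartDeriv x x)

/-- The wedge product of a covector `a` with an alternating form `b`: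
`(a ∧ b)(v₀, …, v_p) = ∑ i, (-1)^i a(v_i) b(v₀, …, v̂_i, …, v_p)`. -/
def wedgeCovector {p : ℕ} (a : (EuclideanSpace ℝ (Fin n)) [⋀^Fin 1]→L[ℝ] ℝ)
    (b : (EuclideanSpace ℝ (Fin n)) [⋀^Fin p]→L[ℝ] ℝ) :
    (EuclideanSpace ℝ (Fin n)) [⋀^Fin (p + 1)]→L[ℝ] ℝ :=
  ContinuousAlternatingMap.alternatizeUncurryFin
    (((ContinuousAlternatingMap.ofSubsingleton ℝ (EuclideanSpace ℝ (Fin n)) ℝ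
      (0 : Fin 1)).symm a).smulRight b)

/-- The wedge product `θ ∧ σ` of a one-form and a `p`-form. -/
def wedge {p : ℕ} (θ : Form n M 1) (σ : Form n M p) : Form n M (p + 1) := fun x =>
  wedgeCovector (θ x) (σ x)

/-- The twisted differential `d_θ σ = d σ + θ ∧ σ`. -/
def twistedD {p : ℕ} (θ : Form n M 1) (σ : Form n M p) : Form n M (p + 1) := fun x =>
  extDer σ x + wedge θ σ x

/-- The basis of `T_x M` given by the coordinate vectors at `x` of the chart around `x`; Mathlib's
`TangentSpace` identifies `T_x M` with `ℝⁿ` through this basis. -/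
def frame (x : M) (i : Fin n) : TangentSpace (𝓡 n) x := stdVec i

/-- The expression of a vector field in the chart around `x₀`. -/
def vecRep (X : (x : M) → TangentSpace (𝓡 n) x) (x₀ : M) (y : EuclideanSpace ℝ (Fin n)) :
    EuclideanSpace ℝ (Fin n) :=
  chartDeriv x₀ ((extChartAt (𝓡 n) x₀).symm y) (X ((extChartAt (𝓡 n) x₀).symm y))

end Charts

section Riemannian

variable {n : ℕ} {M : Type*} [TopologicalSpace M] [ChartedSpace (EuclideanSpace ℝ (Fin n)) M]
  [IsManifold (𝓡 n) ∞ M]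

/-- The inverse `(g^{ij})` of the Gram matrix of the metric at `x` in the basis `frame x`. -/
def gramInv (g : Metric n M) (x : M) : Matrix (Fin n) (Fin n) ℝ :=
  (Matrix.of fun i j => g.inner x (frame x i) (frame x j))⁻¹

/-- The pointwise inner product of `p`-forms induced by `g`:
`⟨α, β⟩ = (1 / p!) ∑ g^{i₁j₁} ⋯ g^{i_pj_p} α_{i₁…i_p} β_{j₁…j_p}`. It does not depend on the basis
of the tangent space, and `e^{i₁} ∧ ⋯ ∧ e^{i_p}`, `i₁ < ⋯ < i_p`, is orthonormal whenever
`e₁, …, e_n` is. -/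
def formInner {p : ℕ} (g : Metric n M) (α β : Form n M p) (x : M) : ℝ :=
  (p.factorial : ℝ)⁻¹ * ∑ I : Fin p → Fin n, ∑ J : Fin p → Fin n,
    (∏ k, gramInv g x (I k) (J k)) * α x (fun k => frame x (I k)) * β x (fun k => frame x (J k))

/-- The matrix `(g_{ij})` of the metric in the chart around `x₀`. -/
def metricRep (g : Metric n M) (x₀ : M) (y : EuclideanSpace ℝ (Fin n)) :
    Matrix (Fin n) (Fin n) ℝ :=
  Matrix.of fun i j => g.inner ((extChartAt (𝓡 n) x₀).symm y)
    (chartSymmDeriv x₀ y (stdVec i)) (chartSymmDeriv x₀ y (stdVec j))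

/-- The partial derivative `∂_k g_{ij}` in the chart around `x₀`. -/
def metricPartial (g : Metric n M) (x₀ : M) (y : EuclideanSpace ℝ (Fin n)) (k i j : Fin n) : ℝ :=
  fderiv ℝ (fun z => metricRep g x₀ z i j) y (stdVec k)

/-- The Christoffel symbol `Γ^k_{ij}` of the Levi-Civita connection in the chart around `x₀`. -/
def christoffel (g : Metric n M) (x₀ : M) (y : EuclideanSpace ℝ (Fin n)) (k i j : Fin n) : ℝ :=
  2⁻¹ * ∑ l, (metricRep g x₀ y)⁻¹ k l *
    (metricPartial g x₀ y i j l + metricPartial g x₀ y j i l - metricPartial g x₀ y l i j)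

/-- The component `(∇_i X)^k = ∂_i X^k + ∑ j, Γ^k_{ij} X^j` of the Levi-Civita covariant derivative
of a vector field at `x`, in the chart around `x`. -/
def covDeriv (g : Metric n M) (X : (x : M) → TangentSpace (𝓡 n) x) (x : M) (k i : Fin n) : ℝ :=
  fderiv ℝ (fun z => vecRep X x z k) (extChartAt (𝓡 n) x x) (stdVec i) +
    ∑ j, christoffel g x (extChartAt (𝓡 n) x x) k i j * vecRep X x (extChartAt (𝓡 n) x x) j

/-- The norm `|∇X| = (∑ g^{ij} g_{kl} (∇_i X)^k (∇_j X)^l)^{1/2}` at `x`. -/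
def gradNorm (g : Metric n M) (X : (x : M) → TangentSpace (𝓡 n) x) (x : M) : ℝ :=
  Real.sqrt (∑ i, ∑ j, ∑ k, ∑ l,
    (metricRep g x (extChartAt (𝓡 n) x x))⁻¹ i j * metricRep g x (extChartAt (𝓡 n) x x) k l *
      covDeriv g X x k i * covDeriv g X x l j)

/-- The divergence of a vector field: the trace of `∇X`. -/
def divergence (g : Metric n M) (X : (x : M) → TangentSpace (𝓡 n) x) (x : M) : ℝ :=
  ∑ i, covDeriv g X x i i

/-- The measure on `M` that lives on the domain of the chart around `x₀` and is
`√(det g_{ij}) dy¹ ⋯ dyⁿ` there. -/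
def chartVolume [MeasurableSpace M] (g : Metric n M) (x₀ : M) : MeasureTheory.Measure M :=
  (((MeasureTheory.volume : MeasureTheory.Measure (EuclideanSpace ℝ (Fin n))).restrict
    (extChartAt (𝓡 n) x₀).target).withDensity
      (fun y => ENNReal.ofReal (Real.sqrt (metricRep g x₀ y).det))).map (extChartAt (𝓡 n) x₀).symm

/-- The Riemannian volume measure `dV`. The measures `chartVolume g x₀` agree on the overlaps of the
charts, and their supremum in the lattice of measures is the measure on `M` whose restriction to the
domain of every chart is the volume in that chart. -/
def riemannianVolume [MeasurableSpace M] (g : Metric n M) : MeasureTheory.Measure M :=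
  ⨆ x₀ : M, chartVolume g x₀

/-- The `p`-form `β` is `d_θ^* α`, where `d_θ^*` is the formal `L²` adjoint of `d_θ`: it is the
(unique) smooth form with `∫ ⟨d_θ γ, α⟩ dV = ∫ ⟨γ, β⟩ dV` for all smooth `p`-forms `γ`. (`M` is
compact in the application, so that all smooth forms are test forms.) -/
def IsAdjoint [MeasurableSpace M] {p : ℕ} (g : Metric n M) (θ : Form n M 1)
    (α : Form n M (p + 1)) (β : Form n M p) : Prop :=
  IsSmooth β ∧ ∀ γ : Form n M p, IsSmooth γ →
    ∫ x, formInner g (twistedD θ γ) α x ∂(riemannianVolume g) =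
      ∫ x, formInner g γ β x ∂(riemannianVolume g)

/-- The `p`-form `L` is `Δ_θ α = d_θ d_θ^* α + d_θ^* d_θ α`. On functions `d_θ^*` vanishes. -/
def IsLaplacian [MeasurableSpace M] (g : Metric n M) (θ : Form n M 1) :
    {p : ℕ} → Form n M p → Form n M p → Prop
  | 0, α, L => IsAdjoint g θ (twistedD θ α) L
  | _ + 1, α, L => ∃ β η, IsAdjoint g θ α β ∧ IsAdjoint g θ (twistedD θ α) η ∧
      L = fun x => twistedD θ β x + η x

/-- `α` is a smooth form with `Δ_θ α = 0`. -/
def IsHarmonic [MeasurableSpace M] {p : ℕ} (g : Metric n M) (θ : Form n M 1)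
    (α : Form n M p) : Prop :=
  IsSmooth α ∧ IsLaplacian g θ α (fun _ => 0)

end Riemannian

end MorseNovikov

end

/-!
Pairing `Δ_θ α = 0` with `α` gives `d_θ α = 0` and `d_θ^* α = 0`. Cartan's formula for `d_θ` reads
`ι_X d_θ + d_θ ι_X = L_X + |X|²`, so pairing it with `α` and integrating yields
`∫ |X|² |α|² = -∫ ⟨L_X α, α⟩`. Moreover `L_X = ∇_X + A`, where `A` is the action of `∇X` on forms as
a derivation, so that `⟨L_X α, α⟩ = ½ X|α|² + ⟨A α, α⟩`. The divergence theorem turns `-½ ∫ X|α|²`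
into `½ ∫ (div X) |α|²`, and `|⟨A α, α⟩| ≤ p |∇X| |α|²` with `p ≤ n` unless `α = 0`.
-/

noncomputable section

namespace MorseNovikov

section LinearAlgebra

variable {n : ℕ}

/-- The model space `ℝⁿ`, with which every tangent space is identified. -/
abbrev Coord (n : ℕ) := EuclideanSpace ℝ (Fin n)

/-- The matrix of an endomorphism of `ℝⁿ` in the standard basis. -/
def matOf : (Coord n →L[ℝ] Coord n) ≃⋆ₐ[ℝ] Matrix (Fin n) (Fin n) ℝ :=
  Matrix.toEuclideanCLM.symm

theorem matOf_apply (L : Coord n →L[ℝ] Coord n) (i j : Fin n) : matOf L i j = L (stdVec j) i := by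
  obtain ⟨A, rfl⟩ := EquivLike.surjective (Matrix.toEuclideanCLM (n := Fin n) (𝕜 := ℝ)) L
  simp [matOf, stdVec]

theorem matOf_comp (L K : Coord n →L[ℝ] Coord n) : matOf (L ∘L K) = matOf L * matOf K :=
  map_mul matOf L K

theorem matOf_id : matOf (ContinuousLinearMap.id ℝ (Coord n)) = 1 :=
  map_one matOf

theorem sum_smul_stdVec (v : Coord n) : ∑ i, v i • stdVec i = v := by
  ext j
  simp [stdVec, Pi.single_apply]

theorem map_stdVec (L : Coord n →L[ℝ] Coord n) (j : Fin n) :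
    L (stdVec j) = ∑ i, matOf L i j • stdVec i := by
  simp only [matOf_apply, sum_smul_stdVec]

/-- The trace `∑ H^{ij} B(e_i, e_j)` of a bilinear form with respect to `H`, which plays the role of
an inverse metric. -/
def bilinTrace (H : Matrix (Fin n) (Fin n) ℝ) (B : Coord n →ₗ[ℝ] Coord n →ₗ[ℝ] ℝ) : ℝ :=
  ∑ i, ∑ j, H i j * B (stdVec i) (stdVec j)

theorem bilinTrace_matOf_mul (L : Coord n →L[ℝ] Coord n) (H : Matrix (Fin n) (Fin n) ℝ)
    (B : Coord n →ₗ[ℝ] Coord n →ₗ[ℝ] ℝ) :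
    bilinTrace (matOf L * H) B = bilinTrace H (B ∘ₗ L) := by
  simp only [bilinTrace, LinearMap.comp_apply, ContinuousLinearMap.coe_coe, map_stdVec, map_sum,
    map_smul, LinearMap.sum_apply, LinearMap.smul_apply, smul_eq_mul, Matrix.mul_apply,
    Finset.sum_mul, Finset.mul_sum]
  rw [Finset.sum_congr rfl fun i _ => Finset.sum_comm, Finset.sum_comm]
  refine Finset.sum_congr rfl fun k _ => ?_
  rw [Finset.sum_comm]
  exact Finset.sum_congr rfl fun j _ => Finset.sum_congr rfl fun i _ => by ring

theorem bilinTrace_flip (H : Matrix (Fin n) (Fin n) ℝ) (B : Coord n →ₗ[ℝ] Coord n →ₗ[ℝ] ℝ) :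
    bilinTrace H B.flip = bilinTrace H.transpose B :=
  Finset.sum_comm

theorem bilinTrace_mul_transpose_matOf (L : Coord n →L[ℝ] Coord n) (H : Matrix (Fin n) (Fin n) ℝ)
    (B : Coord n →ₗ[ℝ] Coord n →ₗ[ℝ] ℝ) :
    bilinTrace (H * (matOf L).transpose) B =
      bilinTrace H (B.compl₂ (L : Coord n →ₗ[ℝ] Coord n)) := by
  rw [← Matrix.transpose_transpose (H * _), ← bilinTrace_flip, Matrix.transpose_mul,
    Matrix.transpose_transpose, bilinTrace_matOf_mul, ← bilinTrace_flip]
  rfl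

end LinearAlgebra

section Contraction

open Matrix

variable {n p : ℕ} (H : Matrix (Fin n) (Fin n) ℝ)

/-- The contraction `∑ H^{i₁j₁} ⋯ H^{i_pj_p} u_{i₁…i_p} w_{j₁…j_p}`, bilinear in `u` and `w`. It is
defined for arbitrary functions of `p` vectors, so that it also applies to the individual terms of
an alternating sum. -/
def contract : ((Fin p → Coord n) → ℝ) →ₗ[ℝ] ((Fin p → Coord n) → ℝ) →ₗ[ℝ] ℝ :=
  ∑ I : Fin p → Fin n, ∑ J : Fin p → Fin n, (∏ k, H (I k) (J k)) •
    LinearMap.BilinForm.linMulLin (LinearMap.proj fun k => stdVec (I k))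
      (LinearMap.proj fun k => stdVec (J k))

theorem contract_apply (u w : (Fin p → Coord n) → ℝ) :
    contract H u w = ∑ I : Fin p → Fin n, ∑ J : Fin p → Fin n,
      (∏ k, H (I k) (J k)) * u (fun k => stdVec (I k)) * w (fun k => stdVec (J k)) := by
  simp [contract, mul_assoc]

theorem contract_comm (u w : (Fin p → Coord n) → ℝ) : contract H u w = contract Hᵀ w u := by
  rw [contract_apply, Finset.sum_comm, contract_apply]
  refine Finset.sum_congr rfl fun I _ => Finset.sum_congr rfl fun J _ => ?_
  simp only [Matrix.transpose_apply]
  ring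

theorem contract_fin_zero (u w : (Fin 0 → Coord n) → ℝ) :
    contract H u w = u Fin.elim0 * w Fin.elim0 := by
  simp only [contract_apply, Finset.univ_unique, Finset.sum_singleton, Finset.univ_eq_empty,
    Finset.prod_empty, one_mul, Subsingleton.elim (fun _ : Fin 0 => _) Fin.elim0]

theorem contract_insertNth (k : Fin (p + 1)) (u w : (Fin (p + 1) → Coord n) → ℝ) :
    contract H u w = ∑ i, ∑ j, H i j *
      contract H (fun v => u (k.insertNth (stdVec i) v))
        (fun v => w (k.insertNth (stdVec j) v)) := by
  have stdVec_insertNth (i : Fin n) (I : Fin p → Fin n) :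
      (fun l => (stdVec ((k.insertNth i I : Fin (p + 1) → Fin n) l) : Coord n)) =
        k.insertNth (α := fun _ => Coord n) (stdVec i) (fun l => stdVec (I l)) :=
    Fin.eq_insertNth_iff.2 ⟨by simp, by funext l; simp [Fin.removeNth]⟩
  rw [contract_apply, ← (Fin.insertNthEquiv (fun _ => Fin n) k).sum_comp, Fintype.sum_prod_type]
  refine Finset.sum_congr rfl fun i _ => ?_
  simp_rw [← (Fin.insertNthEquiv (fun _ => Fin n) k).sum_comp (fun _ => _ * _),
    Fintype.sum_prod_type]
  rw [Finset.sum_comm]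
  refine Finset.sum_congr rfl fun j _ => ?_
  rw [contract_apply, Finset.mul_sum]
  simp only [Finset.mul_sum]
  refine Finset.sum_congr rfl fun I _ => Finset.sum_congr rfl fun J _ => ?_
  simp only [Fin.insertNthEquiv_apply, stdVec_insertNth, Fin.prod_univ_succAbove _ k,
    Fin.insertNth_apply_same, Fin.insertNth_apply_succAbove]
  ring

theorem contract_succ (u w : (Fin (p + 1) → Coord n) → ℝ) :
    contract H u w = ∑ i, ∑ j, H i j *
      contract H (fun v => u (Fin.cons (stdVec i) v)) (fun v => w (Fin.cons (stdVec j) v)) := by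
  simpa only [Fin.insertNth_zero'] using contract_insertNth H 0 u w

/-- The bilinear form `(x, y) ↦ ⟨ι_x a, ι_y b⟩` for the pairing `contract H`. -/
def contractCurry (a b : Coord n [⋀^Fin (p + 1)]→L[ℝ] ℝ) : Coord n →ₗ[ℝ] Coord n →ₗ[ℝ] ℝ :=
  (contract H).compl₁₂
    { toFun := fun x => ⇑(a.curryLeft x)
      map_add' := fun x y => by rw [map_add, ContinuousAlternatingMap.coe_add]
      map_smul' := fun c x => by rw [map_smul, ContinuousAlternatingMap.coe_smul]; rfl }
    { toFun := fun x => ⇑(b.curryLeft x)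
      map_add' := fun x y => by rw [map_add, ContinuousAlternatingMap.coe_add]
      map_smul' := fun c x => by rw [map_smul, ContinuousAlternatingMap.coe_smul]; rfl }

theorem contractCurry_apply (a b : Coord n [⋀^Fin (p + 1)]→L[ℝ] ℝ) (x y : Coord n) :
    contractCurry H a b x y = contract H (a.curryLeft x) (b.curryLeft y) :=
  rfl

theorem contract_eq_bilinTrace (a b : Coord n [⋀^Fin (p + 1)]→L[ℝ] ℝ) :
    contract H a b = bilinTrace H (contractCurry H a b) :=
  contract_succ H a b

theorem contract_curryLeft (a b : Coord n [⋀^Fin (p + 1)]→L[ℝ] ℝ) :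
    contract H a b = ∑ i, ∑ j, H i j *
      contract H (a.curryLeft (stdVec i)) (b.curryLeft (stdVec j)) :=
  contract_succ H a b

theorem contract_matOf_mul_mul_transpose (L : Coord n →L[ℝ] Coord n)
    (K : Matrix (Fin n) (Fin n) ℝ) (a b : Coord n [⋀^Fin p]→L[ℝ] ℝ) :
    contract (matOf L * K * (matOf L)ᵀ) a b =
      contract K (a.compContinuousLinearMap L) (b.compContinuousLinearMap L) := by
  induction p with
  | zero =>
    simp only [contract_fin_zero, ContinuousAlternatingMap.compContinuousLinearMap_apply,
      Subsingleton.elim (_ ∘ _) (Fin.elim0 : Fin 0 → Coord n)]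
  | succ p ih =>
    rw [contract_eq_bilinTrace, bilinTrace_mul_transpose_matOf, bilinTrace_matOf_mul,
      contract_curryLeft]
    refine Finset.sum_congr rfl fun i _ => Finset.sum_congr rfl fun j _ => ?_
    simp only [ContinuousAlternatingMap.curryLeft_compContinuousLinearMap, ← ih]
    rfl

theorem contract_mul_removeNth (k : Fin (p + 1)) (f : Coord n → ℝ) (u : (Fin p → Coord n) → ℝ)
    (w : (Fin (p + 1) → Coord n) → ℝ) :
    contract H (fun v => f (v k) * u (k.removeNth v)) w =
      ∑ i, ∑ j, H i j * f (stdVec i) * contract H u (fun v => w (k.insertNth (stdVec j) v)) := by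
  rw [contract_insertNth H k]
  simp only [Fin.insertNth_apply_same, Fin.removeNth_insertNth]
  refine Finset.sum_congr rfl fun i _ => Finset.sum_congr rfl fun j _ => ?_
  rw [mul_assoc, ← smul_eq_mul (f (stdVec i)), ← LinearMap.smul_apply, ← map_smul]
  rfl

end Contraction

section Derivation

open Matrix

variable {n p : ℕ} (H : Matrix (Fin n) (Fin n) ℝ)

/-- The action `(v₁, …, v_p) ↦ ∑ k, u(v₁, …, Γ v_k, …, v_p)` of an endomorphism `Γ` of `ℝⁿ` as a
derivation. -/
def act (Γ : Coord n →L[ℝ] Coord n) (u : (Fin p → Coord n) → ℝ) (v : Fin p → Coord n) : ℝ :=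
  ∑ k, u (Function.update v k (Γ (v k)))

theorem act_fin_zero (Γ : Coord n →L[ℝ] Coord n) (u : (Fin 0 → Coord n) → ℝ) : act Γ u = 0 := by
  ext v
  simp [act]

theorem act_sub (Γ Γ' : Coord n →L[ℝ] Coord n) (a : Coord n [⋀^Fin p]→L[ℝ] ℝ) :
    act (Γ - Γ') a = act Γ a - act Γ' a := by
  ext v
  simp [act, ContinuousAlternatingMap.map_update_sub]

theorem act_cons (Γ : Coord n →L[ℝ] Coord n) (a : Coord n [⋀^Fin (p + 1)]→L[ℝ] ℝ) (x : Coord n) :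
    (fun w => act Γ a (Fin.cons x w)) = a.curryLeft (Γ x) + act Γ (a.curryLeft x) := by
  ext w
  simp only [act, Fin.sum_univ_succ, Fin.update_cons_zero, Fin.cons_zero, Fin.cons_succ,
    ← Fin.cons_update]
  rfl

theorem act_compContinuousLinearMap {L S T : Coord n →L[ℝ] Coord n} (h : S ∘L L = L ∘L T)
    (a : Coord n [⋀^Fin p]→L[ℝ] ℝ) (v : Fin p → Coord n) :
    act T (a.compContinuousLinearMap L) v = act S a (L ∘ v) := by
  simp only [act, ContinuousAlternatingMap.compContinuousLinearMap_apply]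
  refine Finset.sum_congr rfl fun k _ => congrArg a ?_
  have hk : L (T (v k)) = S (L (v k)) := congrArg (fun f => f (v k)) h.symm
  rw [Function.comp_update]
  exact congrArg _ hk

theorem alternatizeUncurryFin_curryLeft_comp (a : Coord n [⋀^Fin (p + 1)]→L[ℝ] ℝ)
    (Γ : Coord n →L[ℝ] Coord n) :
    ⇑(ContinuousAlternatingMap.alternatizeUncurryFin (a.curryLeft ∘L Γ)) = act Γ a := by
  ext v
  rw [ContinuousAlternatingMap.alternatizeUncurryFin_apply, act]
  refine Finset.sum_congr rfl fun k _ => ?_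
  rw [← Fin.insertNth_removeNth, ContinuousAlternatingMap.map_insertNth]
  rfl

theorem exists_alternating_eq_act (a : Coord n [⋀^Fin p]→L[ℝ] ℝ) (Γ : Coord n →L[ℝ] Coord n) :
    ∃ c : Coord n [⋀^Fin p]→L[ℝ] ℝ, ⇑c = act Γ a := by
  cases p with
  | zero => exact ⟨0, (act_fin_zero Γ a).symm⟩
  | succ p => exact ⟨_, alternatizeUncurryFin_curryLeft_comp a Γ⟩

theorem contract_act_left (Γ : Coord n →L[ℝ] Coord n) (a b : Coord n [⋀^Fin (p + 1)]→L[ℝ] ℝ) :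
    contract H (act Γ a) b =
      bilinTrace (matOf Γ * H) (contractCurry H a b) +
      ∑ i, ∑ j, H i j *
        contract H (act Γ (a.curryLeft (stdVec i))) (b.curryLeft (stdVec j)) := by
  rw [contract_succ, bilinTrace_matOf_mul, bilinTrace]
  simp only [act_cons, map_add, LinearMap.add_apply, mul_add, Finset.sum_add_distrib]
  rfl

theorem contract_act_right (Γ : Coord n →L[ℝ] Coord n) (a b : Coord n [⋀^Fin (p + 1)]→L[ℝ] ℝ) :
    contract H a (act Γ b) =
      bilinTrace (H * (matOf Γ)ᵀ) (contractCurry H a b) +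
      ∑ i, ∑ j, H i j *
        contract H (a.curryLeft (stdVec i)) (act Γ (b.curryLeft (stdVec j))) := by
  rw [contract_succ, bilinTrace_mul_transpose_matOf, bilinTrace]
  simp only [act_cons, map_add, mul_add, Finset.sum_add_distrib]
  rfl

end Derivation

section Positivity

open Matrix

variable {n p : ℕ}

theorem contract_one_apply (u w : (Fin p → Coord n) → ℝ) :
    contract 1 u w =
      ∑ I : Fin p → Fin n, u (fun k => stdVec (I k)) * w (fun k => stdVec (I k)) := by
  rw [contract_apply]
  refine Finset.sum_congr rfl fun I _ => ?_
  rw [Finset.sum_eq_single I]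
  · simp
  · intro J _ hJ
    obtain ⟨k, hk⟩ := Function.ne_iff.1 hJ
    have : (1 : Matrix (Fin n) (Fin n) ℝ) (I k) (J k) = 0 := Matrix.one_apply_ne hk.symm
    rw [Finset.prod_eq_zero (Finset.mem_univ k) this, zero_mul, zero_mul]
  · simp

theorem contract_one_self_nonneg (u : (Fin p → Coord n) → ℝ) : 0 ≤ contract 1 u u := by
  rw [contract_one_apply]
  exact Finset.sum_nonneg fun I _ => mul_self_nonneg _

theorem contract_one_sq_le (u w : (Fin p → Coord n) → ℝ) :
    contract 1 u w ^ 2 ≤ contract 1 u u * contract 1 w w := by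
  simpa only [contract_one_apply, ← sq] using Finset.sum_mul_sq_le_sq_mul_sq Finset.univ
    (fun I : Fin p → Fin n => u fun k => stdVec (I k)) (fun I => w fun k => stdVec (I k))

theorem contract_one_curryLeft (a b : Coord n [⋀^Fin (p + 1)]→L[ℝ] ℝ) :
    contract 1 a b = ∑ i, contract 1 (a.curryLeft (stdVec i)) (b.curryLeft (stdVec i)) := by
  simp [contract_curryLeft, Matrix.one_apply]

theorem abs_bilinTrace_contractCurry_le (A : Matrix (Fin n) (Fin n) ℝ)
    (a : Coord n [⋀^Fin (p + 1)]→L[ℝ] ℝ) :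
    |bilinTrace A (contractCurry 1 a a)| ≤ √(∑ i, ∑ j, A i j ^ 2) * contract 1 a a := by
  set c : Fin n → Fin n → ℝ := fun i j =>
    contract 1 (a.curryLeft (stdVec i)) (a.curryLeft (stdVec j))
  have cauchy_schwarz : (∑ i, ∑ j, A i j * c i j) ^ 2 ≤
      (∑ i, ∑ j, A i j ^ 2) * ∑ i, ∑ j, c i j ^ 2 := by
    simpa only [Fintype.sum_prod_type] using Finset.sum_mul_sq_le_sq_mul_sq Finset.univ
      (fun q : Fin n × Fin n => A q.1 q.2) fun q => c q.1 q.2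
  have sum_sq_le : ∑ i, ∑ j, c i j ^ 2 ≤ contract 1 a a ^ 2 := by
    rw [contract_one_curryLeft, sq, Finset.sum_mul_sum]
    exact Finset.sum_le_sum fun i _ => Finset.sum_le_sum fun j _ => contract_one_sq_le _ _
  have sq_le := cauchy_schwarz.trans
    (mul_le_mul_of_nonneg_left sum_sq_le (by positivity : 0 ≤ ∑ i, ∑ j, A i j ^ 2))
  rw [← Real.sqrt_sq (contract_one_self_nonneg a), ← Real.sqrt_mul (by positivity)]
  exact Real.abs_le_sqrt sq_le

theorem abs_contract_one_act_le (S : Coord n →L[ℝ] Coord n) (a : Coord n [⋀^Fin p]→L[ℝ] ℝ) :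
    |contract 1 (act S a) a| ≤ p * √(∑ i, ∑ j, matOf S i j ^ 2) * contract 1 a a := by
  induction p with
  | zero => simp [act_fin_zero]
  | succ p ih =>
    have tail_le : |∑ i, contract 1 (act S (a.curryLeft (stdVec i))) (a.curryLeft (stdVec i))| ≤
        p * √(∑ i, ∑ j, matOf S i j ^ 2) * contract 1 a a := by
      rw [contract_one_curryLeft, Finset.mul_sum]
      exact (Finset.abs_sum_le_sum_abs _ _).trans (Finset.sum_le_sum fun i _ => ih _)
    have split := contract_act_left 1 S a a
    simp only [Matrix.one_apply, mul_one, ite_mul, one_mul, zero_mul, Finset.sum_ite_eq,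
      Finset.mem_univ, if_true] at split
    rw [split]
    refine (abs_add_le _ _).trans ((add_le_add (abs_bilinTrace_contractCurry_le _ a) tail_le).trans
      (le_of_eq ?_))
    push_cast
    ring

theorem contract_mul_transpose_self (L : Coord n →L[ℝ] Coord n) (a b : Coord n [⋀^Fin p]→L[ℝ] ℝ) :
    contract (matOf L * (matOf L)ᵀ) a b =
      contract 1 (a.compContinuousLinearMap L) (b.compContinuousLinearMap L) := by
  rw [← contract_matOf_mul_mul_transpose, Matrix.mul_one]

open scoped MatrixOrder in
theorem exists_eq_matOf_mul_transpose {H : Matrix (Fin n) (Fin n) ℝ} (hH : H.PosSemidef) :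
    ∃ L : Coord n →L[ℝ] Coord n, H = matOf L * (matOf L)ᵀ := by
  obtain ⟨B, hB⟩ := CStarAlgebra.nonneg_iff_eq_mul_star_self.1 (Matrix.nonneg_iff_posSemidef.2 hH)
  exact ⟨matOf.symm B, by rw [StarAlgEquiv.apply_symm_apply]; exact hB⟩

variable {H : Matrix (Fin n) (Fin n) ℝ}

theorem contract_self_nonneg (hH : H.PosSemidef) (a : Coord n [⋀^Fin p]→L[ℝ] ℝ) :
    0 ≤ contract H a a := by
  obtain ⟨L, rfl⟩ := exists_eq_matOf_mul_transpose hH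
  rw [contract_mul_transpose_self]
  exact contract_one_self_nonneg _

theorem contract_eq_zero_of_self (hH : H.PosSemidef) {a : Coord n [⋀^Fin p]→L[ℝ] ℝ}
    (ha : contract H a a = 0) (b : Coord n [⋀^Fin p]→L[ℝ] ℝ) : contract H a b = 0 := by
  obtain ⟨L, rfl⟩ := exists_eq_matOf_mul_transpose hH
  rw [contract_mul_transpose_self] at ha ⊢
  refine pow_eq_zero_iff two_ne_zero |>.1 (le_antisymm ?_ (sq_nonneg _))
  simpa [ha] using contract_one_sq_le (a.compContinuousLinearMap L) (b.compContinuousLinearMap L)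

/-- The squared Hilbert-Schmidt norm, with respect to the metric `G`, of the endomorphism with
matrix `S`. -/
def hsSq (G S : Matrix (Fin n) (Fin n) ℝ) : ℝ :=
  (G⁻¹ * Sᵀ * G * S).trace

theorem hsSq_one (S : Matrix (Fin n) (Fin n) ℝ) : hsSq 1 S = ∑ i, ∑ j, S i j ^ 2 := by
  rw [Finset.sum_comm]
  simp [hsSq, Matrix.trace, Matrix.mul_apply, sq]

theorem hsSq_conj {Q : Matrix (Fin n) (Fin n) ℝ} (hQ : IsUnit Q.det)
    (G S : Matrix (Fin n) (Fin n) ℝ) : hsSq (Qᵀ * G * Q) (Q⁻¹ * S * Q) = hsSq G S := by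
  have hQt : IsUnit Qᵀ.det := by rwa [Matrix.det_transpose]
  calc hsSq (Qᵀ * G * Q) (Q⁻¹ * S * Q)
      = (Q⁻¹ * (G⁻¹ * ((Qᵀ)⁻¹ * Qᵀ) * Sᵀ * ((Qᵀ)⁻¹ * Qᵀ) * G * (Q * Q⁻¹) * S * Q)).trace := by
        simp only [hsSq, Matrix.mul_inv_rev, Matrix.transpose_mul, Matrix.transpose_nonsing_inv,
          Matrix.mul_assoc]
    _ = hsSq G S := by
        rw [Matrix.nonsing_inv_mul _ hQt, Matrix.mul_nonsing_inv _ hQ, Matrix.trace_mul_comm]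
        simp only [hsSq, Matrix.mul_one, Matrix.mul_assoc, Matrix.mul_nonsing_inv _ hQ]

theorem abs_contract_act_le {G : Matrix (Fin n) (Fin n) ℝ} (hG : G.PosDef)
    (S : Coord n →L[ℝ] Coord n) (a : Coord n [⋀^Fin p]→L[ℝ] ℝ) :
    |contract G⁻¹ (act S a) a| ≤ p * √(hsSq G (matOf S)) * contract G⁻¹ a a := by
  obtain ⟨L, hL⟩ := exists_eq_matOf_mul_transpose hG.inv.posSemidef
  have hdet : IsUnit (matOf L).det := by
    have := (Matrix.isUnit_iff_isUnit_det _).1 hG.inv.isUnit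
    rw [hL, Matrix.det_mul] at this
    exact isUnit_of_mul_isUnit_left this
  have orthonormal : (matOf L)ᵀ * G * matOf L = 1 := by
    have inv_mul : (matOf L)ᵀ * G = (matOf L)⁻¹ := by
      rw [← Matrix.nonsing_inv_mul_cancel_left (matOf L) ((matOf L)ᵀ * G) hdet,
        ← Matrix.mul_assoc (matOf L), ← hL,
        Matrix.nonsing_inv_mul _ ((Matrix.isUnit_iff_isUnit_det _).1 hG.isUnit), Matrix.mul_one]
    rw [inv_mul, Matrix.nonsing_inv_mul _ hdet]
  set T : Coord n →L[ℝ] Coord n := matOf.symm ((matOf L)⁻¹ * matOf S * matOf L) with hT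
  have hST : S ∘L L = L ∘L T := by
    apply EquivLike.injective matOf
    rw [matOf_comp, matOf_comp, hT, StarAlgEquiv.apply_symm_apply, ← Matrix.mul_assoc,
      Matrix.mul_nonsing_inv_cancel_left _ _ hdet]
  have norm_eq : ∑ i, ∑ j, matOf T i j ^ 2 = hsSq G (matOf S) := by
    rw [← hsSq_one, ← orthonormal, hT, StarAlgEquiv.apply_symm_apply, hsSq_conj hdet]
  obtain ⟨c, hc⟩ := exists_alternating_eq_act a S
  have pullback : ⇑(c.compContinuousLinearMap L) = act T (a.compContinuousLinearMap L) := by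
    ext v
    rw [act_compContinuousLinearMap hST, ← hc]
    rfl
  rw [← hc, hL, contract_mul_transpose_self, contract_mul_transpose_self, pullback, ← norm_eq]
  exact abs_contract_one_act_le T _

end Positivity

section InteriorProduct

open ContinuousAlternatingMap

variable {n p : ℕ}

/-- The interior product `ι_x` with a vector. -/
def interiorProd (x : Coord n) :
    (Coord n [⋀^Fin (p + 1)]→L[ℝ] ℝ) →L[ℝ] (Coord n [⋀^Fin p]→L[ℝ] ℝ) :=
  curryLeftLI.toContinuousLinearMap.flip x

theorem alternating_eq_zero_of_lt (hp : n < p) (a : Coord n [⋀^Fin p]→L[ℝ] ℝ) : a = 0 := by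
  ext v
  refine a.toAlternatingMap.map_linearDependent v fun h => ?_
  have := h.fintype_card_le_finrank
  simp only [Fintype.card_fin, finrank_euclideanSpace] at this
  omega

theorem wedgeCovector_apply (θ : Coord n [⋀^Fin 1]→L[ℝ] ℝ) (b : Coord n [⋀^Fin p]→L[ℝ] ℝ)
    (v : Fin (p + 1) → Coord n) :
    wedgeCovector θ b v = ∑ k, (-1) ^ k.val * (θ (fun _ => v k) * b (k.removeNth v)) := by
  simp [wedgeCovector, alternatizeUncurryFin_apply]

/-- The vector dual to a covector with respect to the inverse metric `H`. -/
def sharp (H : Matrix (Fin n) (Fin n) ℝ) (θ : Coord n [⋀^Fin 1]→L[ℝ] ℝ) : Coord n :=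
  ∑ i, ∑ j, (H i j * θ (fun _ => stdVec i)) • stdVec j

theorem contract_wedgeCovector (H : Matrix (Fin n) (Fin n) ℝ) (θ : Coord n [⋀^Fin 1]→L[ℝ] ℝ)
    (b : Coord n [⋀^Fin p]→L[ℝ] ℝ) (a : Coord n [⋀^Fin (p + 1)]→L[ℝ] ℝ) :
    contract H (wedgeCovector θ b) a = (p + 1) * contract H b (a.curryLeft (sharp H θ)) := by
  have eq_sum : ⇑(wedgeCovector θ b) = ∑ k : Fin (p + 1), (-1 : ℝ) ^ k.val •
      fun v : Fin (p + 1) → Coord n => θ (fun _ => v k) * b (k.removeNth v) := by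
    ext v
    simp [wedgeCovector_apply]
  have sharp_expand : ⇑(a.curryLeft (sharp H θ)) =
      ∑ i, ∑ j, (H i j * θ (fun _ => stdVec i)) • ⇑(a.curryLeft (stdVec j)) := by
    ext v
    simp [sharp]
  have term_eq (k : Fin (p + 1)) :
      contract H (fun v => θ (fun _ => v k) * b (k.removeNth v)) a =
        (-1) ^ k.val * contract H b (a.curryLeft (sharp H θ)) := by
    have insertNth_eq (j : Fin n) : (fun v => a (k.insertNth (stdVec j) v)) =
        (-1 : ℝ) ^ k.val • ⇑(a.curryLeft (stdVec j)) := by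
      ext v
      simp [ContinuousAlternatingMap.map_insertNth]
    rw [contract_mul_removeNth H k fun x => θ fun _ => x, sharp_expand]
    simp only [insertNth_eq, _root_.map_sum, map_smul, smul_eq_mul, Finset.mul_sum]
    exact Finset.sum_congr rfl fun i _ => Finset.sum_congr rfl fun j _ => by ring
  simp only [eq_sum, _root_.map_sum, map_smul, LinearMap.sum_apply, LinearMap.smul_apply, term_eq,
    smul_eq_mul, ← mul_assoc, ← mul_pow]
  simp

theorem curryLeft_alternatizeUncurryFin_add (f : Coord n →L[ℝ] Coord n [⋀^Fin (p + 1)]→L[ℝ] ℝ)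
    (x : Coord n) :
    (alternatizeUncurryFin f).curryLeft x +
      alternatizeUncurryFin (interiorProd x ∘L f) = f x := by
  ext v
  have removeNth_cons (k : Fin (p + 1)) :
      Fin.removeNth k.succ (Fin.cons x v : Fin (p + 2) → Coord n) = Fin.cons x (k.removeNth v) := by
    ext1 l
    refine Fin.cases ?_ (fun l => ?_) l <;> simp [Fin.removeNth]
  suffices alternatizeUncurryFin f (Fin.cons x v) +
      alternatizeUncurryFin (interiorProd x ∘L f) v = f x v from this
  rw [alternatizeUncurryFin_apply, alternatizeUncurryFin_apply, Fin.sum_univ_succ (n := p + 1),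
    add_assoc, ← Finset.sum_add_distrib, Finset.sum_eq_zero]
  · simp [Fin.removeNth_zero]
  · intro k _
    rw [removeNth_cons, Fin.val_succ, Fin.cons_succ, pow_succ, mul_neg_one, neg_smul]
    exact neg_add_cancel _

theorem curryLeft_alternatizeUncurryFin_zero (f : Coord n →L[ℝ] Coord n [⋀^Fin 0]→L[ℝ] ℝ)
    (x : Coord n) : (alternatizeUncurryFin f).curryLeft x = f x := by
  ext v
  suffices alternatizeUncurryFin f (Fin.cons x v) = f x v from this
  simp [alternatizeUncurryFin_apply, Fin.removeNth_zero]

theorem curryLeft_wedgeCovector_add (θ : Coord n [⋀^Fin 1]→L[ℝ] ℝ)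
    (a : Coord n [⋀^Fin (p + 1)]→L[ℝ] ℝ) (x : Coord n) :
    (wedgeCovector θ a).curryLeft x + wedgeCovector θ (a.curryLeft x) = θ (fun _ => x) • a := by
  have := curryLeft_alternatizeUncurryFin_add
    (((ofSubsingleton ℝ (Coord n) ℝ (0 : Fin 1)).symm θ).smulRight a) x
  have interior_smulRight : interiorProd x ∘L
      ((ofSubsingleton ℝ (Coord n) ℝ (0 : Fin 1)).symm θ).smulRight a =
        ((ofSubsingleton ℝ (Coord n) ℝ (0 : Fin 1)).symm θ).smulRight (a.curryLeft x) := by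
    ext v w
    simp [interiorProd]
  rw [interior_smulRight] at this
  simpa [wedgeCovector] using this

theorem curryLeft_wedgeCovector_zero (θ : Coord n [⋀^Fin 1]→L[ℝ] ℝ)
    (a : Coord n [⋀^Fin 0]→L[ℝ] ℝ) (x : Coord n) :
    (wedgeCovector θ a).curryLeft x = θ (fun _ => x) • a := by
  rw [wedgeCovector, curryLeft_alternatizeUncurryFin_zero]
  simp

theorem cartan {σ : Coord n → Coord n [⋀^Fin (p + 1)]→L[ℝ] ℝ} {X : Coord n → Coord n}
    {y : Coord n} (hσ : DifferentiableAt ℝ σ y) (hX : DifferentiableAt ℝ X y) :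
    ⇑((extDeriv σ y).curryLeft (X y) + extDeriv (fun z => (σ z).curryLeft (X z)) y) =
      fderiv ℝ σ y (X y) + act (fderiv ℝ X y) (σ y) := by
  have hasFDerivAt_interior : HasFDerivAt (fun z => (σ z).curryLeft (X z))
      (interiorProd (X y) ∘L fderiv ℝ σ y +
        (σ y).curryLeft ∘L fderiv ℝ X y) y :=
    (curryLeftLI.toContinuousLinearMap.hasFDerivAt_of_bilinear hσ.hasFDerivAt
      hX.hasFDerivAt).congr_fderiv (add_comm _ _)
  rw [extDeriv, extDeriv, hasFDerivAt_interior.fderiv, alternatizeUncurryFin_add, ← add_assoc,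
    curryLeft_alternatizeUncurryFin_add, coe_add, alternatizeUncurryFin_curryLeft_comp]

theorem cartan_zero (σ : Coord n → Coord n [⋀^Fin 0]→L[ℝ] ℝ) (x y : Coord n) :
    (extDeriv σ y).curryLeft x = fderiv ℝ σ y x := by
  rw [extDeriv, curryLeft_alternatizeUncurryFin_zero]

end InteriorProduct

theorem exists_hasDerivAt {E : Type*} [NormedAddCommGroup E] [NormedSpace ℝ E] (y v : E) :
    ∃ γ : ℝ → E, γ 0 = y ∧ HasDerivAt γ v 0 :=
  ⟨fun t => y + t • v, by simp, by simpa using ((hasDerivAt_id (0 : ℝ)).smul_const v).const_add y⟩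

section MatrixCalculus

open Matrix

variable {n p : ℕ} {A : ℝ → Matrix (Fin n) (Fin n) ℝ} {A' Γ : Matrix (Fin n) (Fin n) ℝ} {t : ℝ}

theorem hasDerivAt_matrix :
    HasDerivAt A A' t ↔ ∀ i j, HasDerivAt (fun s => A s i j) (A' i j) t :=
  hasDerivAt_pi.trans (forall_congr' fun _ => hasDerivAt_pi)

open scoped Matrix.Norms.Operator in
theorem hasDerivAt_matrix_inv (hA : HasDerivAt A A' t) (hdet : IsUnit (A t).det) :
    HasDerivAt (fun s => (A s)⁻¹) (-((A t)⁻¹ * A' * (A t)⁻¹)) t := by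
  obtain ⟨u, hu⟩ := (Matrix.isUnit_iff_isUnit_det _).2 hdet
  have inv_eq : (A t)⁻¹ = ↑u⁻¹ := by rw [← hu, Matrix.coe_units_inv]
  simp only [Matrix.nonsing_inv_eq_ringInverse] at inv_eq ⊢
  rw [inv_eq]
  have := hasFDerivAt_ringInverse (𝕜 := ℝ) u
  rw [hu] at this
  exact this.comp_hasDerivAt t hA

open scoped Matrix.Norms.Operator in
theorem hasDerivAt_inv_of_transpose_mul_add_mul (hA : HasDerivAt A (Γᵀ * A t + A t * Γ) t)
    (hdet : IsUnit (A t).det) :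
    HasDerivAt (fun s => (A s)⁻¹) (-(Γ * (A t)⁻¹ + (A t)⁻¹ * Γᵀ)) t := by
  refine HasDerivAt.congr_deriv (hasDerivAt_matrix_inv hA hdet) ?_
  rw [Matrix.mul_add, Matrix.add_mul, ← Matrix.mul_assoc, ← Matrix.mul_assoc,
    Matrix.mul_nonsing_inv_cancel_right _ _ hdet, Matrix.nonsing_inv_mul _ hdet, Matrix.one_mul,
    add_comm]

theorem hasDerivAt_det (hA : HasDerivAt A A' t) :
    HasDerivAt (fun s => (A s).det) ((A t).adjugate * A').trace t := by
  let f : ContinuousMultilinearMap ℝ (fun _ : Fin n => Fin n → ℝ) ℝ :=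
    { (Matrix.detRowAlternating (n := Fin n) (R := ℝ)).toMultilinearMap with
      cont := (continuous_id (X := Matrix (Fin n) (Fin n) ℝ)).matrix_det }
  have rows : HasDerivAt (fun s => (fun i => A s i : Fin n → Fin n → ℝ)) (fun i => A' i) t :=
    hasDerivAt_pi.2 fun i => hasDerivAt_pi.2 (hasDerivAt_matrix.1 hA i)
  refine ((f.hasFDerivAt (fun i => A t i)).comp_hasDerivAt t rows).congr_deriv ?_
  rw [ContinuousMultilinearMap.linearDeriv_apply, Matrix.trace_mul_comm]
  refine Finset.sum_congr rfl fun i _ => ?_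
  have det_updateRow : f (Function.update (fun i => A t i) i (A' i)) =
      ((A t).updateRow i (A' i)).det := rfl
  rw [det_updateRow, ← Matrix.cramer_transpose_apply, Matrix.cramer_eq_adjugate_mulVec,
    Matrix.diag_apply, Matrix.mul_apply, ← Matrix.adjugate_transpose]
  simp [Matrix.mulVec, dotProduct, mul_comm]

theorem hasDerivAt_sqrt_det (hA : HasDerivAt A (Γᵀ * A t + A t * Γ) t) (hpos : 0 < (A t).det) :
    HasDerivAt (fun s => √(A s).det) (√(A t).det * Γ.trace) t := by
  refine ((hasDerivAt_det hA).sqrt hpos.ne').congr_deriv ?_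
  have trace_eq : ((A t).adjugate * (Γᵀ * A t + A t * Γ)).trace = 2 * (A t).det * Γ.trace := by
    rw [Matrix.mul_add, Matrix.trace_add, ← Matrix.mul_assoc, Matrix.trace_mul_comm,
      ← Matrix.mul_assoc, ← Matrix.mul_assoc, Matrix.mul_adjugate, Matrix.adjugate_mul]
    simp
    ring
  have sqrt_ne_zero : √(A t).det ≠ 0 := (Real.sqrt_pos.2 hpos).ne'
  rw [trace_eq]
  field_simp
  rw [Real.sq_sqrt hpos.le, mul_comm]

theorem contDiffOn_matrix_det {E : Type*} [NormedAddCommGroup E] [NormedSpace ℝ E]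
    {A : E → Matrix (Fin n) (Fin n) ℝ} {s : Set E} {r : WithTop ℕ∞}
    (hA : ∀ i j, ContDiffOn ℝ r (fun y => A y i j) s) : ContDiffOn ℝ r (fun y => (A y).det) s := by
  simp only [Matrix.det_apply]
  exact ContDiffOn.sum fun σ _ => (contDiffOn_prod fun k _ => hA _ _).const_smul _

open scoped Matrix.Norms.Operator in
theorem contDiffOn_matrix_inv {E : Type*} [NormedAddCommGroup E] [NormedSpace ℝ E]
    {A : E → Matrix (Fin n) (Fin n) ℝ} {s : Set E} {r : WithTop ℕ∞}
    (hA : ∀ i j, ContDiffOn ℝ r (fun y => A y i j) s) (hdet : ∀ y ∈ s, IsUnit (A y).det)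
    (i j : Fin n) : ContDiffOn ℝ r (fun y => (A y)⁻¹ i j) s := by
  have contDiffOn_A : ContDiffOn ℝ r A s := by
    rw [show A = fun y => ∑ i, ∑ j, A y i j • Matrix.single i j (1 : ℝ) from funext fun y => by
      simpa using Matrix.matrix_eq_sum_single (A y)]
    exact ContDiffOn.sum fun i _ => ContDiffOn.sum fun j _ => (hA i j).smul contDiffOn_const
  have contDiffOn_inv : ContDiffOn ℝ r (fun y => (A y)⁻¹) s := fun y hy => by
    obtain ⟨u, hu⟩ := (Matrix.isUnit_iff_isUnit_det _).2 (hdet y hy)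
    simp only [Matrix.nonsing_inv_eq_ringInverse]
    exact (hu ▸ contDiffAt_ringInverse ℝ u).comp_contDiffWithinAt y (contDiffOn_A y hy)
  exact (LinearMap.toContinuousLinearMap
    (Matrix.entryLinearMap ℝ ℝ i j)).contDiff.comp_contDiffOn contDiffOn_inv

theorem hasDerivAt_contract {H : ℝ → Matrix (Fin n) (Fin n) ℝ} (Γ : Coord n →L[ℝ] Coord n)
    (hH : HasDerivAt H (-(matOf Γ * H t + H t * (matOf Γ)ᵀ)) t)
    {a b : ℝ → Coord n [⋀^Fin p]→L[ℝ] ℝ} {a' b' : Coord n [⋀^Fin p]→L[ℝ] ℝ}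
    (ha : HasDerivAt a a' t) (hb : HasDerivAt b b' t) :
    HasDerivAt (fun s => contract (H s) (a s) (b s))
      (contract (H t) a' (b t) + contract (H t) (a t) b' - contract (H t) (act Γ (a t)) (b t) -
        contract (H t) (a t) (act Γ (b t))) t := by
  induction p with
  | zero =>
    simp only [contract_fin_zero, act_fin_zero, map_zero, LinearMap.zero_apply, sub_zero]
    exact ((ContinuousAlternatingMap.apply ℝ (Coord n) ℝ Fin.elim0).hasFDerivAt.comp_hasDerivAt t
      ha).fun_mul
      ((ContinuousAlternatingMap.apply ℝ (Coord n) ℝ Fin.elim0).hasFDerivAt.comp_hasDerivAt t hb)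
  | succ p ih =>
    have hasDerivAt_curryLeft {c : ℝ → Coord n [⋀^Fin (p + 1)]→L[ℝ] ℝ}
        {c' : Coord n [⋀^Fin (p + 1)]→L[ℝ] ℝ} (hc : HasDerivAt c c' t) (v : Coord n) :
        HasDerivAt (fun s => (c s).curryLeft v) (c'.curryLeft v) t :=
      (interiorProd v).hasFDerivAt.comp_hasDerivAt t hc
    have sum_deriv := HasDerivAt.fun_sum (u := Finset.univ) fun (i : Fin n) _ =>
      HasDerivAt.fun_sum (u := Finset.univ) fun (j : Fin n) _ =>
        (hasDerivAt_matrix.1 hH i j).fun_mul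
          (ih (hasDerivAt_curryLeft ha (stdVec i)) (hasDerivAt_curryLeft hb (stdVec j)))
    simp only [contract_curryLeft]
    refine sum_deriv.congr_deriv ?_
    rw [contract_act_left, contract_act_right]
    simp only [bilinTrace, contractCurry_apply, ← Finset.sum_add_distrib,
      ← Finset.sum_sub_distrib]
    refine Finset.sum_congr rfl fun i _ => Finset.sum_congr rfl fun j _ => ?_
    simp only [Matrix.neg_apply, Matrix.add_apply]
    ring

open MeasureTheory in
theorem integral_fderiv_eq_zero {F : Coord n → ℝ} (hF : ContDiff ℝ 1 F)
    (hc : HasCompactSupport F) (v : Coord n) : ∫ y, fderiv ℝ F y v = 0 := by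
  obtain ⟨C, hC⟩ := hF.lipschitzWith_of_hasCompactSupport hc one_ne_zero
  have parts := (LipschitzWith.const (1 : ℝ)).integral_lineDeriv_mul_eq (μ := volume) hC hc (-v)
  have lineDeriv_eq (y : Coord n) : lineDeriv ℝ F y v = fderiv ℝ F y v :=
    ((hF.differentiable one_ne_zero) y).lineDeriv_eq_fderiv
  simp only [neg_neg, mul_one, lineDeriv_eq] at parts
  simp [← parts, lineDeriv]

end MatrixCalculus

section ChartCalculus

open Set
open scoped Topology

variable {n p : ℕ} {M : Type*} [TopologicalSpace M] [ChartedSpace (EuclideanSpace ℝ (Fin n)) M]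
  {x₀ x₁ x : M} {y : Coord n}

/-- The derivative at `x` of the chart around `x₀`, as an endomorphism of `ℝⁿ`: `T_x M` is
identified with `ℝⁿ` through the chart around `x`. -/
def toChart (x₀ x : M) : Coord n →L[ℝ] Coord n := chartDeriv x₀ x

/-- The derivative at the image of `x` of the inverse of the chart around `x₀`, as an endomorphism
of `ℝⁿ`: `T_x M` is identified with `ℝⁿ` through the chart around `x`. -/
def ofChart (x₀ x : M) : Coord n →L[ℝ] Coord n := chartSymmDeriv x₀ (extChartAt (𝓡 n) x₀ x)

/-- The change of coordinates from the chart around `x₀` to the chart around `x₁`. -/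
def transition (x₀ x₁ : M) : Coord n → Coord n :=
  extChartAt (𝓡 n) x₁ ∘ (extChartAt (𝓡 n) x₀).symm

/-- The value of a form at `x`, with `T_x M` identified with `ℝⁿ` through the chart around `x`. -/
def formAt (σ : Form n M p) (x : M) : Coord n [⋀^Fin p]→L[ℝ] ℝ := σ x

theorem formRep_extChartAt (σ : Form n M p) (hx : x ∈ (extChartAt (𝓡 n) x₀).source) :
    formRep σ x₀ (extChartAt (𝓡 n) x₀ x) =
      (formAt σ x).compContinuousLinearMap (ofChart x₀ x) :=
  congrArg (fun z => (formAt σ z).compContinuousLinearMap (ofChart x₀ x))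
    ((extChartAt (𝓡 n) x₀).left_inv hx)

/-- The value of a vector field at `x`, with `T_x M` identified with `ℝⁿ` through the chart around
`x`. -/
def vecAt (X : (x : M) → TangentSpace (𝓡 n) x) (x : M) : Coord n := X x

theorem vecRep_extChartAt (X : (x : M) → TangentSpace (𝓡 n) x)
    (hx : x ∈ (extChartAt (𝓡 n) x₀).source) :
    vecRep X x₀ (extChartAt (𝓡 n) x₀ x) = toChart x₀ x (vecAt X x) :=
  congrArg (fun z => toChart x₀ z (vecAt X z)) ((extChartAt (𝓡 n) x₀).left_inv hx)

theorem exists_extChartAt_eq (hy : y ∈ (extChartAt (𝓡 n) x₀).target) :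
    ∃ x ∈ (extChartAt (𝓡 n) x₀).source, extChartAt (𝓡 n) x₀ x = y :=
  ⟨_, (extChartAt (𝓡 n) x₀).map_target hy, (extChartAt (𝓡 n) x₀).right_inv hy⟩

theorem transition_extChartAt (hx₀ : x ∈ (extChartAt (𝓡 n) x₀).source) :
    transition x₀ x₁ (extChartAt (𝓡 n) x₀ x) = extChartAt (𝓡 n) x₁ x := by
  rw [transition, Function.comp_apply, (extChartAt (𝓡 n) x₀).left_inv hx₀]

theorem isOpen_transition_domain (x₀ x₁ : M) :
    IsOpen ((extChartAt (𝓡 n) x₀).target ∩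
      (extChartAt (𝓡 n) x₀).symm ⁻¹' (extChartAt (𝓡 n) x₁).source) :=
  (continuousOn_extChartAt_symm x₀).isOpen_inter_preimage (isOpen_extChartAt_target x₀)
    (isOpen_extChartAt_source x₁)

theorem extChartAt_mem_transition_domain (hx₀ : x ∈ (extChartAt (𝓡 n) x₀).source)
    (hx₁ : x ∈ (extChartAt (𝓡 n) x₁).source) :
    extChartAt (𝓡 n) x₀ x ∈ (extChartAt (𝓡 n) x₀).target ∩
      (extChartAt (𝓡 n) x₀).symm ⁻¹' (extChartAt (𝓡 n) x₁).source :=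
  ⟨(extChartAt (𝓡 n) x₀).map_source hx₀, by
    rwa [mem_preimage, (extChartAt (𝓡 n) x₀).left_inv hx₀]⟩

theorem eventually_exists_extChartAt_eq (hx₀ : x ∈ (extChartAt (𝓡 n) x₀).source)
    (hx₁ : x ∈ (extChartAt (𝓡 n) x₁).source) :
    ∀ᶠ y in 𝓝 (extChartAt (𝓡 n) x₀ x), ∃ z ∈ (extChartAt (𝓡 n) x₀).source,
      z ∈ (extChartAt (𝓡 n) x₁).source ∧ extChartAt (𝓡 n) x₀ z = y := by
  filter_upwards [(isOpen_transition_domain x₀ x₁).mem_nhds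
    (extChartAt_mem_transition_domain hx₀ hx₁)] with y hy
  exact ⟨_, (extChartAt (𝓡 n) x₀).map_target hy.1, hy.2, (extChartAt (𝓡 n) x₀).right_inv hy.1⟩

variable [IsManifold (𝓡 n) ∞ M]

theorem contDiffAt_transition (hx₀ : x ∈ (extChartAt (𝓡 n) x₀).source)
    (hx₁ : x ∈ (extChartAt (𝓡 n) x₁).source) :
    ContDiffAt ℝ ∞ (transition x₀ x₁) (extChartAt (𝓡 n) x₀ x) :=
  (contDiffOn_ext_coord_change (I := 𝓡 n) (n := ∞) x₁ x₀).contDiffAt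
    ((isOpen_transition_domain x₀ x₁).mem_nhds (extChartAt_mem_transition_domain hx₀ hx₁))

theorem mdifferentiableAt_symm (hy : y ∈ (extChartAt (𝓡 n) x₀).target) :
    MDifferentiableAt (𝓡 n) (𝓡 n) (extChartAt (𝓡 n) x₀).symm y :=
  (contMDiffOn_extChartAt_symm (n := ∞) x₀).contMDiffAt
    ((isOpen_extChartAt_target x₀).mem_nhds hy) |>.mdifferentiableAt (by simp)

theorem fderiv_transition (hx₀ : x ∈ (extChartAt (𝓡 n) x₀).source)
    (hx₁ : x ∈ (extChartAt (𝓡 n) x₁).source) :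
    fderiv ℝ (transition x₀ x₁) (extChartAt (𝓡 n) x₀ x) = toChart x₁ x ∘L ofChart x₀ x := by
  have : IsManifold (𝓡 n) 1 M := IsManifold.of_le (n := ∞) (by simp)
  have left_inv := (extChartAt (𝓡 n) x₀).left_inv hx₀
  have mdifferentiableAt_chart : MDifferentiableAt (𝓡 n) 𝓘(ℝ, Coord n) (extChartAt (𝓡 n) x₁)
      ((extChartAt (𝓡 n) x₀).symm (extChartAt (𝓡 n) x₀ x)) := by
    rw [left_inv]
    exact mdifferentiableAt_extChartAt (by simpa using hx₁)
  have chain := mfderiv_comp (extChartAt (𝓡 n) x₀ x) mdifferentiableAt_chart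
    (mdifferentiableAt_symm ((extChartAt (𝓡 n) x₀).map_source hx₀))
  rw [mfderiv_eq_fderiv] at chain
  exact chain.trans (congrArg (fun z => toChart x₁ z ∘L ofChart x₀ x) left_inv)

theorem toChart_self (x : M) : toChart x x = ContinuousLinearMap.id ℝ (Coord n) :=
  have : IsManifold (𝓡 n) 1 M := IsManifold.of_le (n := ∞) (by simp)
  mfderiv_extChartAt_self

theorem toChart_comp_ofChart (hx : x ∈ (extChartAt (𝓡 n) x₀).source) :
    toChart x₀ x ∘L ofChart x₀ x = ContinuousLinearMap.id ℝ (Coord n) := by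
  have transition_eq_id : transition x₀ x₀ =ᶠ[𝓝 (extChartAt (𝓡 n) x₀ x)] id := by
    filter_upwards [extChartAt_target_mem_nhds' ((extChartAt (𝓡 n) x₀).map_source hx)] with y hy
    exact (extChartAt (𝓡 n) x₀).right_inv hy
  rw [← fderiv_transition hx hx, transition_eq_id.fderiv_eq, fderiv_id]

theorem ofChart_comp_toChart (hx : x ∈ (extChartAt (𝓡 n) x₀).source) :
    ofChart x₀ x ∘L toChart x₀ x = ContinuousLinearMap.id ℝ (Coord n) := by
  have mul_eq_one := congrArg matOf (toChart_comp_ofChart hx)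
  rw [matOf_comp, matOf_id] at mul_eq_one
  apply EquivLike.injective matOf
  rw [matOf_comp, matOf_id, mul_eq_one_comm.1 mul_eq_one]

theorem ofChart_toChart_apply (hx : x ∈ (extChartAt (𝓡 n) x₀).source) (v : Coord n) :
    ofChart x₀ x (toChart x₀ x v) = v :=
  DFunLike.congr_fun (ofChart_comp_toChart hx) v

theorem ofChart_self (x : M) : ofChart x x = ContinuousLinearMap.id ℝ (Coord n) := by
  simpa only [toChart_self, ContinuousLinearMap.id_comp] using
    toChart_comp_ofChart (mem_extChartAt_source (I := 𝓡 n) x)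

theorem isUnit_matOf_ofChart (hx : x ∈ (extChartAt (𝓡 n) x₀).source) :
    IsUnit (matOf (n := n) (ofChart x₀ x)).det := by
  have mul_eq_one := congrArg matOf (toChart_comp_ofChart hx)
  rw [matOf_comp, matOf_id] at mul_eq_one
  exact (Matrix.isUnit_iff_isUnit_det _).1 (IsUnit.of_mul_eq_one_right _ mul_eq_one)

theorem ofChart_comp_fderiv_transition (hx₀ : x ∈ (extChartAt (𝓡 n) x₀).source)
    (hx₁ : x ∈ (extChartAt (𝓡 n) x₁).source) :
    ofChart x₁ x ∘L fderiv ℝ (transition x₀ x₁) (extChartAt (𝓡 n) x₀ x) = ofChart x₀ x := by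
  rw [fderiv_transition hx₀ hx₁, ← ContinuousLinearMap.comp_assoc, ofChart_comp_toChart hx₁,
    ContinuousLinearMap.id_comp]

end ChartCalculus

section ChartMetric

open Matrix

variable {n : ℕ} {M : Type*} [TopologicalSpace M] [ChartedSpace (EuclideanSpace ℝ (Fin n)) M]
  [IsManifold (𝓡 n) ∞ M] {x₀ x : M} {y : Coord n}

/-- The metric at `x`, with `T_x M` identified with `ℝⁿ` through the chart around `x`. -/
def metricForm (g : Metric n M) (x : M) : Coord n →L[ℝ] Coord n →L[ℝ] ℝ := g.inner x

/-- The Gram matrix of the metric at `x` in the basis `frame x`. -/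
def gram (g : Metric n M) (x : M) : Matrix (Fin n) (Fin n) ℝ :=
  Matrix.of fun i j => metricForm g x (stdVec i) (stdVec j)

theorem metricForm_eq_dotProduct (g : Metric n M) (x : M) (v w : Coord n) :
    metricForm g x v w = v.ofLp ⬝ᵥ gram g x *ᵥ w.ofLp := by
  conv_lhs => rw [← sum_smul_stdVec v, ← sum_smul_stdVec w]
  simp only [_root_.map_sum, map_smul, _root_.sum_apply, _root_.smul_apply, smul_eq_mul,
    Finset.mul_sum, dotProduct, mulVec, gram, Matrix.of_apply]
  rw [Finset.sum_comm]
  exact Finset.sum_congr rfl fun i _ => Finset.sum_congr rfl fun j _ => by ring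

theorem metricRep_extChartAt (g : Metric n M) (hx : x ∈ (extChartAt (𝓡 n) x₀).source)
    (i j : Fin n) : metricRep g x₀ (extChartAt (𝓡 n) x₀ x) i j =
      metricForm g x (ofChart x₀ x (stdVec i)) (ofChart x₀ x (stdVec j)) :=
  congrArg (fun z => metricForm g z (ofChart x₀ x (stdVec i)) (ofChart x₀ x (stdVec j)))
    ((extChartAt (𝓡 n) x₀).left_inv hx)

theorem metricRep_eq_transpose_mul (g : Metric n M) (hx : x ∈ (extChartAt (𝓡 n) x₀).source) :
    metricRep g x₀ (extChartAt (𝓡 n) x₀ x) =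
      (matOf (ofChart x₀ x))ᵀ * gram g x * matOf (ofChart x₀ x) := by
  ext i j
  rw [metricRep_extChartAt g hx, metricForm_eq_dotProduct, Matrix.mul_assoc, Matrix.mul_apply']
  congr 1

theorem metricRep_self (g : Metric n M) (x : M) :
    metricRep g x (extChartAt (𝓡 n) x x) = gram g x := by
  rw [metricRep_eq_transpose_mul g (mem_extChartAt_source x), ofChart_self, matOf_id,
    Matrix.transpose_one, Matrix.one_mul, Matrix.mul_one]

theorem gram_transpose (g : Metric n M) (x : M) : (gram g x)ᵀ = gram g x :=
  Matrix.ext fun _ _ => g.symm x _ _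

theorem gram_posDef (g : Metric n M) (x : M) : (gram g x).PosDef := by
  refine Matrix.PosDef.of_dotProduct_mulVec_pos ?_ fun {v} hv => ?_
  · rw [Matrix.IsHermitian, Matrix.conjTranspose_eq_transpose_of_trivial, gram_transpose]
  · have := metricForm_eq_dotProduct g x (WithLp.toLp 2 v) (WithLp.toLp 2 v)
    exact this ▸ g.pos x _ fun h => hv (congrArg WithLp.ofLp h)

theorem metricRep_posDef (g : Metric n M) (hy : y ∈ (extChartAt (𝓡 n) x₀).target) :
    (metricRep g x₀ y).PosDef := by
  obtain ⟨x, hx, rfl⟩ := exists_extChartAt_eq hy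
  have := (gram_posDef g x).conjTranspose_mul_mul_same (B := matOf (ofChart x₀ x))
    (Matrix.mulVec_injective_iff_isUnit.2
      ((Matrix.isUnit_iff_isUnit_det _).2 (isUnit_matOf_ofChart hx)))
  rwa [Matrix.conjTranspose_eq_transpose_of_trivial, ← metricRep_eq_transpose_mul g hx] at this

theorem isUnit_metricRep_det (g : Metric n M) (hy : y ∈ (extChartAt (𝓡 n) x₀).target) :
    IsUnit (metricRep g x₀ y).det :=
  (metricRep_posDef g hy).det_pos.ne'.isUnit

theorem metricRep_transpose (g : Metric n M) (x₀ : M) (y : Coord n) :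
    (metricRep g x₀ y)ᵀ = metricRep g x₀ y :=
  Matrix.ext fun _ _ => g.symm _ _ _

theorem contMDiffOn_chartSymmDeriv (x₀ : M) (v : Coord n) :
    ContMDiffOn (𝓡 n) ((𝓡 n).prod 𝓘(ℝ, Coord n)) ∞
      (fun y => (⟨(extChartAt (𝓡 n) x₀).symm y, chartSymmDeriv x₀ y v⟩ :
        Bundle.TotalSpace (Coord n) (TangentSpace (𝓡 n) (M := M))))
      (extChartAt (𝓡 n) x₀).target := by
  have isOpen_target := isOpen_extChartAt_target (I := 𝓡 n) x₀
  have constant_section : ContMDiffOn (𝓡 n) ((𝓡 n).prod 𝓘(ℝ, Coord n)) ∞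
      (fun y => (⟨y, v⟩ : TangentBundle (𝓡 n) (Coord n))) (extChartAt (𝓡 n) x₀).target := by
    refine fun y _ => Bundle.contMDiffWithinAt_totalSpace.2 ⟨contMDiffWithinAt_id, ?_⟩
    simpa using! contMDiffWithinAt_const
  refine (((contMDiffOn_extChartAt_symm (n := ∞) x₀).contMDiffOn_tangentMapWithin (m := ∞)
    (by simp) isOpen_target.uniqueMDiffOn).comp constant_section fun _ hy => hy).congr
      fun y hy => ?_
  simp only [Function.comp_apply, tangentMapWithin]
  rw [mfderivWithin_of_isOpen isOpen_target hy]
  rfl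

theorem contDiffOn_metricRep (g : Metric n M) (x₀ : M) (i j : Fin n) :
    ContDiffOn ℝ ∞ (fun y => metricRep g x₀ y i j) (extChartAt (𝓡 n) x₀).target := by
  have metric_section : ContMDiffOn (𝓡 n) ((𝓡 n).prod 𝓘(ℝ, Coord n →L[ℝ] Coord n →L[ℝ] ℝ)) ∞
      (fun y => Bundle.TotalSpace.mk' (Coord n →L[ℝ] Coord n →L[ℝ] ℝ)
        (E := fun x : M => TangentSpace (𝓡 n) x →L[ℝ] TangentSpace (𝓡 n) x →L[ℝ] ℝ)
        ((extChartAt (𝓡 n) x₀).symm y) (g.inner ((extChartAt (𝓡 n) x₀).symm y)))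
      (extChartAt (𝓡 n) x₀).target :=
    g.contMDiff.comp_contMDiffOn (contMDiffOn_extChartAt_symm x₀)
  have evaluated := ContMDiffOn.clm_bundle_apply₂ (F₁ := Coord n) (F₂ := Coord n) (F₃ := ℝ)
    (E₃ := Bundle.Trivial M ℝ) metric_section (contMDiffOn_chartSymmDeriv x₀ (stdVec i))
    (contMDiffOn_chartSymmDeriv x₀ (stdVec j))
  refine contMDiffOn_iff_contDiffOn.1 fun y hy => ?_
  simpa using! (Bundle.contMDiffWithinAt_totalSpace.1 (evaluated y hy)).2

theorem contDiffOn_metricRep_inv (g : Metric n M) (x₀ : M) (i j : Fin n) :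
    ContDiffOn ℝ ∞ (fun y => (metricRep g x₀ y)⁻¹ i j) (extChartAt (𝓡 n) x₀).target :=
  contDiffOn_matrix_inv (contDiffOn_metricRep g x₀) (fun _ hy => isUnit_metricRep_det g hy) i j

end ChartMetric

section ChartForms

open scoped Topology

variable {n p : ℕ} {M : Type*} [TopologicalSpace M] [ChartedSpace (EuclideanSpace ℝ (Fin n)) M]
  {θ : Form n M 1} {σ τ : Form n M p} {x₀ x₁ x : M} {y : Coord n}

/-- Interior multiplication of a form by a vector field. -/
def interiorMul (X : (x : M) → TangentSpace (𝓡 n) x) (σ : Form n M (p + 1)) : Form n M p :=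
  fun x => (formAt σ x).curryLeft (vecAt X x)

theorem wedgeCovector_comp (a : Coord n [⋀^Fin 1]→L[ℝ] ℝ) (b : Coord n [⋀^Fin p]→L[ℝ] ℝ)
    (L : Coord n →L[ℝ] Coord n) : (wedgeCovector a b).compContinuousLinearMap L =
      wedgeCovector (a.compContinuousLinearMap L) (b.compContinuousLinearMap L) := by
  ext v
  simp only [ContinuousAlternatingMap.compContinuousLinearMap_apply, wedgeCovector_apply]
  rfl

theorem formRep_wedge (θ : Form n M 1) (σ : Form n M p)
    (hy : y ∈ (extChartAt (𝓡 n) x₀).target) :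
    formRep (wedge θ σ) x₀ y = wedgeCovector (formRep θ x₀ y) (formRep σ x₀ y) := by
  obtain ⟨x, hx, rfl⟩ := exists_extChartAt_eq hy
  rw [formRep_extChartAt _ hx, formRep_extChartAt _ hx, formRep_extChartAt _ hx,
    ← wedgeCovector_comp]
  rfl

theorem IsSmooth.contDiffAt (hσ : IsSmooth σ) (hy : y ∈ (extChartAt (𝓡 n) x₀).target) :
    ContDiffAt ℝ ∞ (formRep σ x₀) y :=
  (hσ x₀).contDiffAt ((isOpen_extChartAt_target x₀).mem_nhds hy)

theorem IsSmooth.add (hσ : IsSmooth σ) (hτ : IsSmooth τ) : IsSmooth (fun x => σ x + τ x) :=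
  fun x₀ => (hσ x₀).add (hτ x₀)

theorem IsSmooth.wedge (hθ : IsSmooth θ) (hσ : IsSmooth σ) : IsSmooth (wedge θ σ) := by
  refine fun x₀ => ContDiffOn.congr ?_ fun y hy => formRep_wedge θ σ hy
  have contDiffOn_covector := (ContinuousAlternatingMap.ofSubsingletonLIE (𝕜 := ℝ) (E := Coord n)
    (F := ℝ) (0 : Fin 1)).symm.contDiff.comp_contDiffOn (hθ x₀)
  exact (ContinuousAlternatingMap.alternatizeUncurryFinCLM ℝ (Coord n) ℝ).contDiff.comp_contDiffOn
    (contDiffOn_covector.smulRight (hσ x₀))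

variable [IsManifold (𝓡 n) ∞ M]

theorem formRep_interiorMul (X : (x : M) → TangentSpace (𝓡 n) x) (σ : Form n M (p + 1))
    (hy : y ∈ (extChartAt (𝓡 n) x₀).target) :
    formRep (interiorMul X σ) x₀ y = (formRep σ x₀ y).curryLeft (vecRep X x₀ y) := by
  obtain ⟨x, hx, rfl⟩ := exists_extChartAt_eq hy
  rw [formRep_extChartAt _ hx, formRep_extChartAt _ hx, vecRep_extChartAt _ hx,
    ContinuousAlternatingMap.curryLeft_compContinuousLinearMap, ofChart_toChart_apply hx]
  rfl

theorem formRep_transition (σ : Form n M p) (hx₀ : x ∈ (extChartAt (𝓡 n) x₀).source)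
    (hx₁ : x ∈ (extChartAt (𝓡 n) x₁).source) :
    formRep σ x₀ (extChartAt (𝓡 n) x₀ x) =
      (formRep σ x₁ (transition x₀ x₁ (extChartAt (𝓡 n) x₀ x))).compContinuousLinearMap
        (fderiv ℝ (transition x₀ x₁) (extChartAt (𝓡 n) x₀ x)) := by
  rw [transition_extChartAt hx₀, formRep_extChartAt _ hx₁, formRep_extChartAt _ hx₀,
    ← ofChart_comp_fderiv_transition hx₀ hx₁]
  rfl

theorem extDeriv_formRep_transition (hσ : IsSmooth σ) (hx₀ : x ∈ (extChartAt (𝓡 n) x₀).source)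
    (hx₁ : x ∈ (extChartAt (𝓡 n) x₁).source) :
    extDeriv (formRep σ x₀) (extChartAt (𝓡 n) x₀ x) =
      (extDeriv (formRep σ x₁) (extChartAt (𝓡 n) x₁ x)).compContinuousLinearMap
        (fderiv ℝ (transition x₀ x₁) (extChartAt (𝓡 n) x₀ x)) := by
  have formRep_eq_pullback : formRep σ x₀ =ᶠ[𝓝 (extChartAt (𝓡 n) x₀ x)] fun y =>
      (formRep σ x₁ (transition x₀ x₁ y)).compContinuousLinearMap
        (fderiv ℝ (transition x₀ x₁) y) := by
    filter_upwards [eventually_exists_extChartAt_eq hx₀ hx₁] with y hy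
    obtain ⟨z, hz₀, hz₁, rfl⟩ := hy
    exact formRep_transition σ hz₀ hz₁
  have differentiableAt_formRep :
      DifferentiableAt ℝ (formRep σ x₁) (transition x₀ x₁ (extChartAt (𝓡 n) x₀ x)) := by
    rw [transition_extChartAt hx₀]
    exact (hσ.contDiffAt ((extChartAt (𝓡 n) x₁).map_source hx₁)).differentiableAt (by simp)
  rw [formRep_eq_pullback.extDeriv_eq, extDeriv_pullback (r := ∞) differentiableAt_formRep
    (contDiffAt_transition hx₀ hx₁)
    (by rw [minSmoothness_of_isRCLikeNormedField]; exact ENat.LEInfty.out),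
    transition_extChartAt hx₀]

theorem formRep_extDer (hσ : IsSmooth σ) (hy : y ∈ (extChartAt (𝓡 n) x₀).target) :
    formRep (extDer σ) x₀ y = extDeriv (formRep σ x₀) y := by
  obtain ⟨x, hx, rfl⟩ := exists_extChartAt_eq hy
  have formAt_extDer : formAt (extDer σ) x =
      (extDeriv (formRep σ x) (extChartAt (𝓡 n) x x)).compContinuousLinearMap (toChart x x) := rfl
  have fderiv_eq := fderiv_transition hx (mem_extChartAt_source (I := 𝓡 n) x)
  rw [toChart_self, ContinuousLinearMap.id_comp] at fderiv_eq
  rw [extDeriv_formRep_transition hσ hx (mem_extChartAt_source x), fderiv_eq,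
    formRep_extChartAt _ hx, formAt_extDer, toChart_self]
  rfl

theorem IsSmooth.extDer (hσ : IsSmooth σ) : IsSmooth (extDer σ) := by
  refine fun x₀ => ContDiffOn.congr ?_ fun y hy => formRep_extDer hσ hy
  exact (ContinuousAlternatingMap.alternatizeUncurryFinCLM ℝ (Coord n) ℝ).contDiff.comp_contDiffOn
    ((hσ x₀).fderiv_of_isOpen (m := ∞) (isOpen_extChartAt_target x₀) (by simp))

theorem IsSmooth.twistedD (hθ : IsSmooth θ) (hσ : IsSmooth σ) : IsSmooth (twistedD θ σ) :=
  hσ.extDer.add (hθ.wedge hσ)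

end ChartForms

section Flat

open Matrix

variable {n p : ℕ} {M : Type*} [TopologicalSpace M] [ChartedSpace (EuclideanSpace ℝ (Fin n)) M]
  {X : (x : M) → TangentSpace (𝓡 n) x} {x₀ : M} {y : Coord n}

/-- A vector field is smooth if its expressions in the charts are smooth. -/
def IsSmoothField (X : (x : M) → TangentSpace (𝓡 n) x) : Prop :=
  ∀ x₀ : M, ContDiffOn ℝ ∞ (vecRep X x₀) (extChartAt (𝓡 n) x₀).target

theorem IsSmoothField.contDiffAt (hX : IsSmoothField X)
    (hy : y ∈ (extChartAt (𝓡 n) x₀).target) : ContDiffAt ℝ ∞ (vecRep X x₀) y :=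
  (hX x₀).contDiffAt ((isOpen_extChartAt_target x₀).mem_nhds hy)

variable [IsManifold (𝓡 n) ∞ M]

theorem IsSmooth.interiorMul {σ : Form n M (p + 1)} (hσ : IsSmooth σ) (hX : IsSmoothField X) :
    IsSmooth (interiorMul X σ) := by
  refine fun x₀ => ContDiffOn.congr ?_ fun y hy => formRep_interiorMul X σ hy
  have contDiff_curryLeft :
      ContDiff ℝ ∞ (fun a : Coord n [⋀^Fin (p + 1)]→L[ℝ] ℝ => a.curryLeft) :=
    IsBoundedLinearMap.contDiff
      ⟨⟨fun _ _ => rfl, fun _ _ => rfl⟩, 1, one_pos, fun a => by simp⟩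
  exact (contDiff_curryLeft.comp_contDiffOn (hσ x₀)).clm_apply (hX x₀)

variable {g : Metric n M}

/-- The one-form `X^♭ = g(X, ·)` dual to a vector field. -/
def flat (g : Metric n M) (X : (x : M) → TangentSpace (𝓡 n) x) : Form n M 1 := fun x =>
  ContinuousAlternatingMap.ofSubsingleton ℝ (Coord n) ℝ (0 : Fin 1) (metricForm g x (vecAt X x))

theorem eq_flat {θ : Form n M 1}
    (hX : ∀ (x : M) (v : TangentSpace (𝓡 n) x), g.inner x (X x) v = θ x (fun _ => v)) :
    θ = flat g X := by
  funext x
  ext v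
  rw [show v = fun _ => v 0 from funext fun i => congrArg v (Subsingleton.elim i 0)]
  exact (hX x (v 0)).symm

theorem formRep_flat (g : Metric n M) (X : (x : M) → TangentSpace (𝓡 n) x)
    (hy : y ∈ (extChartAt (𝓡 n) x₀).target) (j : Fin n) :
    formRep (flat g X) x₀ y (fun _ => stdVec j) = ∑ i, vecRep X x₀ y i * metricRep g x₀ y i j := by
  obtain ⟨x, hx, rfl⟩ := exists_extChartAt_eq hy
  have eq_metricForm : formRep (flat g X) x₀ (extChartAt (𝓡 n) x₀ x) (fun _ => stdVec j) =
      metricForm g x (vecAt X x) (ofChart x₀ x (stdVec j)) := by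
    rw [formRep_extChartAt _ hx]
    rfl
  have expand_X : ∑ i, vecRep X x₀ (extChartAt (𝓡 n) x₀ x) i • ofChart x₀ x (stdVec i) =
      vecAt X x := by
    simp only [← map_smul, ← map_sum, sum_smul_stdVec]
    rw [vecRep_extChartAt _ hx, ofChart_toChart_apply hx]
  rw [eq_metricForm, ← expand_X]
  simp only [metricRep_extChartAt g hx, _root_.map_sum, map_smul, _root_.sum_apply,
    _root_.smul_apply, smul_eq_mul]

theorem vecRep_eq_sharp (g : Metric n M) (X : (x : M) → TangentSpace (𝓡 n) x)
    (hy : y ∈ (extChartAt (𝓡 n) x₀).target) :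
    vecRep X x₀ y = sharp (metricRep g x₀ y)⁻¹ (formRep (flat g X) x₀ y) := by
  have mul_inv := Matrix.mul_nonsing_inv _ (isUnit_metricRep_det g hy)
  have covector_eq : (fun j => formRep (flat g X) x₀ y (fun _ => stdVec j)) =
      (vecRep X x₀ y).ofLp ᵥ* metricRep g x₀ y := funext fun j => formRep_flat g X hy j
  ext j
  calc vecRep X x₀ y j = ((vecRep X x₀ y).ofLp ᵥ* metricRep g x₀ y ᵥ* (metricRep g x₀ y)⁻¹) j := by
        rw [vecMul_vecMul, mul_inv, vecMul_one]
    _ = sharp (metricRep g x₀ y)⁻¹ (formRep (flat g X) x₀ y) j := by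
        rw [← covector_eq]
        simp [sharp, vecMul, dotProduct, stdVec, Pi.single_apply, mul_comm]

theorem IsSmoothField.of_flat (h : IsSmooth (flat g X)) : IsSmoothField X := fun x₀ => by
  refine ContDiffOn.congr ?_ fun y hy => vecRep_eq_sharp g X hy
  refine ContDiffOn.sum fun i _ => ContDiffOn.sum fun j _ =>
    ((contDiffOn_metricRep_inv g x₀ i j).mul ?_).smul contDiffOn_const
  exact (ContinuousAlternatingMap.apply ℝ (Coord n) ℝ
    (fun _ : Fin 1 => stdVec i)).contDiff.comp_contDiffOn (h x₀)

theorem IsSmoothField.flat (hX : IsSmoothField X) (g : Metric n M) :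
    IsSmooth (flat g X) := fun x₀ => by
  have expand (a : Coord n [⋀^Fin 1]→L[ℝ] ℝ) : a = ∑ j, a (fun _ => stdVec j) •
      ContinuousAlternatingMap.ofSubsingleton ℝ (Coord n) ℝ (0 : Fin 1)
        (EuclideanSpace.proj j : Coord n →L[ℝ] ℝ) := by
    obtain ⟨f, rfl⟩ := (ContinuousAlternatingMap.ofSubsingleton ℝ (Coord n) ℝ
      (0 : Fin 1)).surjective a
    ext v
    conv_lhs => rw [ContinuousAlternatingMap.ofSubsingleton_apply_apply, ← sum_smul_stdVec (v 0)]
    simp [mul_comm]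
  refine ContDiffOn.congr (f := fun y => ∑ j, (∑ i, vecRep X x₀ y i * metricRep g x₀ y i j) •
    ContinuousAlternatingMap.ofSubsingleton ℝ (Coord n) ℝ (0 : Fin 1)
      (EuclideanSpace.proj j : Coord n →L[ℝ] ℝ)) ?_ fun y hy => ?_
  · exact ContDiffOn.sum fun j _ => (ContDiffOn.sum fun i _ =>
      (contDiffOn_euclidean.1 (hX x₀) i).mul (contDiffOn_metricRep g x₀ i j)).smul contDiffOn_const
  · simp only [← formRep_flat g X hy]
    exact expand _

end Flat

section Covariant

open Matrix
open scoped Topology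

variable {n : ℕ} {M : Type*} [TopologicalSpace M] [ChartedSpace (EuclideanSpace ℝ (Fin n)) M]

/-- The Jacobian matrix `(∂_i X^k)` of the expression of a vector field in a chart. -/
def jacobian (X : (x : M) → TangentSpace (𝓡 n) x) (x₀ : M) (y : Coord n) :
    Matrix (Fin n) (Fin n) ℝ :=
  matOf (fderiv ℝ (vecRep X x₀) y)

/-- The components `∂_i θ_k - ∂_k θ_i` of the exterior derivative of a one-form in a chart. -/
def curlMat (θ : Form n M 1) (x₀ : M) (y : Coord n) : Matrix (Fin n) (Fin n) ℝ :=
  Matrix.of fun k i => extDeriv (formRep θ x₀) y ![stdVec i, stdVec k]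

theorem curlMat_transpose (θ : Form n M 1) (x₀ : M) (y : Coord n) :
    (curlMat θ x₀ y)ᵀ = -curlMat θ x₀ y := by
  ext k i
  have swap : ![stdVec k, stdVec i] = ![stdVec i, stdVec k] ∘ Equiv.swap (0 : Fin 2) 1 :=
    funext fun l => by fin_cases l <;> rfl
  rw [Matrix.transpose_apply, Matrix.neg_apply, curlMat, Matrix.of_apply, Matrix.of_apply, swap]
  exact (extDeriv (formRep θ x₀) y).toAlternatingMap.map_swap _ (by decide)

theorem jacobian_apply {X : (x : M) → TangentSpace (𝓡 n) x} {x₀ : M} {y : Coord n}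
    (hX : DifferentiableAt ℝ (vecRep X x₀) y) (k i : Fin n) :
    jacobian X x₀ y k i = fderiv ℝ (fun z => vecRep X x₀ z k) y (stdVec i) := by
  have hasFDerivAt_component :=
    (EuclideanSpace.proj k : Coord n →L[ℝ] ℝ).hasFDerivAt.comp y hX.hasFDerivAt
  rw [jacobian, matOf_apply]
  exact (DFunLike.congr_fun hasFDerivAt_component.fderiv (stdVec i)).symm

/-- The Jacobian matrix of a change of coordinates. -/
def transitionMat (x₀ x₁ : M) (y : Coord n) : Matrix (Fin n) (Fin n) ℝ :=
  matOf (fderiv ℝ (transition x₀ x₁) y)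

/-- The directional derivative along `v` of the Jacobian matrix of a change of coordinates. -/
def transitionMatDeriv (x₀ x₁ : M) (y v : Coord n) : Matrix (Fin n) (Fin n) ℝ :=
  matOf (fderiv ℝ (fderiv ℝ (transition x₀ x₁)) y v)

variable [IsManifold (𝓡 n) ∞ M]

/-- The directional derivative along `v` of the matrix of the metric in a chart. -/
def metricDeriv (g : Metric n M) (x₀ : M) (y v : Coord n) : Matrix (Fin n) (Fin n) ℝ :=
  Matrix.of fun i j => fderiv ℝ (fun z => metricRep g x₀ z i j) y v

/-- The components `∑ j, ∂_i g_{kj} X^j` of the derivative of the metric contracted with `X`. -/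
def metricDerivMul (g : Metric n M) (X : (x : M) → TangentSpace (𝓡 n) x) (x₀ : M) (y : Coord n) :
    Matrix (Fin n) (Fin n) ℝ :=
  Matrix.of fun k i => ∑ j, metricDeriv g x₀ y (stdVec i) k j * vecRep X x₀ y j

/-- The Lie derivative of the metric along a vector field, in a chart. -/
def lieMat (g : Metric n M) (X : (x : M) → TangentSpace (𝓡 n) x) (x₀ : M) (y : Coord n) :
    Matrix (Fin n) (Fin n) ℝ :=
  metricDeriv g x₀ y (vecRep X x₀ y) + (jacobian X x₀ y)ᵀ * metricRep g x₀ y +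
    metricRep g x₀ y * jacobian X x₀ y

/-- The components `(∇_i X)^k` of the covariant derivative of a vector field in a chart. -/
def covMat (g : Metric n M) (X : (x : M) → TangentSpace (𝓡 n) x) (x₀ : M) (y : Coord n) :
    Matrix (Fin n) (Fin n) ℝ :=
  Matrix.of fun k i => fderiv ℝ (fun z => vecRep X x₀ z k) y (stdVec i) +
    ∑ j, christoffel g x₀ y k i j * vecRep X x₀ y j

variable {g : Metric n M} {X : (x : M) → TangentSpace (𝓡 n) x} {x₀ x₁ x : M} {y : Coord n}

theorem differentiableAt_metricRep (g : Metric n M) (hy : y ∈ (extChartAt (𝓡 n) x₀).target)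
    (i j : Fin n) : DifferentiableAt ℝ (fun z => metricRep g x₀ z i j) y :=
  ((contDiffOn_metricRep g x₀ i j).contDiffAt
    ((isOpen_extChartAt_target x₀).mem_nhds hy)).differentiableAt (by simp)

theorem hasDerivAt_metricRep (g : Metric n M) {γ : ℝ → Coord n} {v : Coord n} {t : ℝ}
    (hγ : HasDerivAt γ v t) (hγt : γ t ∈ (extChartAt (𝓡 n) x₀).target) :
    HasDerivAt (fun s => metricRep g x₀ (γ s)) (metricDeriv g x₀ (γ t) v) t :=
  hasDerivAt_matrix.2 fun i j =>
    (differentiableAt_metricRep g hγt i j).hasFDerivAt.comp_hasDerivAt t hγ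

theorem metricDeriv_transpose (g : Metric n M) (x₀ : M) (y v : Coord n) :
    (metricDeriv g x₀ y v)ᵀ = metricDeriv g x₀ y v := by
  ext i j
  have symm : (fun z => metricRep g x₀ z j i) = fun z => metricRep g x₀ z i j :=
    funext fun z => congrFun (congrFun (metricRep_transpose g x₀ z) i) j
  rw [Matrix.transpose_apply, metricDeriv, Matrix.of_apply, Matrix.of_apply, symm]

theorem metricDeriv_comm (g : Metric n M) (x₀ : M) (y v : Coord n) (i j : Fin n) :
    metricDeriv g x₀ y v i j = metricDeriv g x₀ y v j i :=
  congrFun (congrFun (metricDeriv_transpose g x₀ y v) j) i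

theorem metricRep_comm (g : Metric n M) (x₀ : M) (y : Coord n) (i j : Fin n) :
    metricRep g x₀ y i j = metricRep g x₀ y j i :=
  g.symm _ _ _

theorem metricDeriv_vecRep (g : Metric n M) (X : (x : M) → TangentSpace (𝓡 n) x) (x₀ : M)
    (y : Coord n) (i j : Fin n) : metricDeriv g x₀ y (vecRep X x₀ y) i j =
      ∑ k, metricDeriv g x₀ y (stdVec k) i j * vecRep X x₀ y k := by
  rw [metricDeriv, Matrix.of_apply]
  conv_lhs => rw [← sum_smul_stdVec (vecRep X x₀ y)]
  simp only [metricDeriv, map_sum, map_smul, smul_eq_mul, Matrix.of_apply, mul_comm]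

theorem lieMat_transpose (g : Metric n M) (X : (x : M) → TangentSpace (𝓡 n) x) (x₀ : M)
    (y : Coord n) : (lieMat g X x₀ y)ᵀ = lieMat g X x₀ y := by
  simp only [lieMat, Matrix.transpose_add, Matrix.transpose_mul, Matrix.transpose_transpose,
    metricRep_transpose, metricDeriv_transpose]
  abel

theorem metricRep_mul_covMat (hX : DifferentiableAt ℝ (vecRep X x₀) y)
    (hy : y ∈ (extChartAt (𝓡 n) x₀).target) :
    (2 : ℝ) • (metricRep g x₀ y * covMat g X x₀ y) =
      metricDeriv g x₀ y (vecRep X x₀ y) + metricDerivMul g X x₀ y - (metricDerivMul g X x₀ y)ᵀ +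
        (2 : ℝ) • (metricRep g x₀ y * jacobian X x₀ y) := by
  let Γ : Matrix (Fin n) (Fin n) ℝ := Matrix.of fun m i => ∑ j,
    (metricDeriv g x₀ y (stdVec i) j m + metricDeriv g x₀ y (stdVec j) i m -
      metricDeriv g x₀ y (stdVec m) i j) * vecRep X x₀ y j
  have covMat_eq : covMat g X x₀ y =
      jacobian X x₀ y + (2 : ℝ)⁻¹ • ((metricRep g x₀ y)⁻¹ * Γ) := by
    ext k i
    have christoffel_eq (j : Fin n) : christoffel g x₀ y k i j =
        2⁻¹ * ∑ l, (metricRep g x₀ y)⁻¹ k l * (metricDeriv g x₀ y (stdVec i) j l +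
          metricDeriv g x₀ y (stdVec j) i l - metricDeriv g x₀ y (stdVec l) i j) := rfl
    simp only [covMat, Γ, Matrix.of_apply, Matrix.add_apply, Matrix.smul_apply, Matrix.mul_apply,
      jacobian_apply hX, christoffel_eq, smul_eq_mul, Finset.mul_sum, Finset.sum_mul, mul_assoc]
    rw [Finset.sum_comm]
  have Γ_eq : Γ = metricDeriv g x₀ y (vecRep X x₀ y) + metricDerivMul g X x₀ y -
      (metricDerivMul g X x₀ y)ᵀ := by
    ext m i
    simp only [Γ, metricDerivMul, Matrix.of_apply, Matrix.add_apply, Matrix.sub_apply,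
      Matrix.transpose_apply, metricDeriv_vecRep, ← Finset.sum_add_distrib,
      ← Finset.sum_sub_distrib]
    refine Finset.sum_congr rfl fun j _ => ?_
    rw [metricDeriv_comm g x₀ y (stdVec i) j m, metricDeriv_comm g x₀ y (stdVec j) i m]
    ring
  rw [covMat_eq, ← Γ_eq, Matrix.mul_add, Matrix.mul_smul, smul_add, smul_smul,
    mul_inv_cancel₀ two_ne_zero, one_smul, ← Matrix.mul_assoc,
    Matrix.mul_nonsing_inv _ (isUnit_metricRep_det g hy), Matrix.one_mul, add_comm]

theorem fderiv_formRep_flat (hX : DifferentiableAt ℝ (vecRep X x₀) y)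
    (hy : y ∈ (extChartAt (𝓡 n) x₀).target) (i k : Fin n) :
    fderiv ℝ (fun z => formRep (flat g X) x₀ z fun _ => stdVec k) y (stdVec i) =
      (metricDerivMul g X x₀ y + metricRep g x₀ y * jacobian X x₀ y) k i := by
  have formRep_eq : (fun z => formRep (flat g X) x₀ z fun _ => stdVec k) =ᶠ[𝓝 y]
      fun z => ∑ j, vecRep X x₀ z j * metricRep g x₀ z j k := by
    filter_upwards [(isOpen_extChartAt_target x₀).mem_nhds hy] with z hz
    exact formRep_flat g X hz k
  have hasFDerivAt_term (j : Fin n) :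
      HasFDerivAt (fun z => vecRep X x₀ z j * metricRep g x₀ z j k) _ y :=
    (differentiableAt_euclidean.1 hX j).hasFDerivAt.mul
      (differentiableAt_metricRep g hy j k).hasFDerivAt
  have hasFDerivAt_sum := HasFDerivAt.fun_sum (u := Finset.univ) fun j _ => hasFDerivAt_term j
  rw [formRep_eq.fderiv_eq, hasFDerivAt_sum.fderiv]
  simp only [metricDerivMul, Matrix.add_apply, Matrix.of_apply, Matrix.mul_apply,
    jacobian_apply hX, _root_.sum_apply, _root_.add_apply, _root_.smul_apply, smul_eq_mul,
    ← Finset.sum_add_distrib]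
  refine Finset.sum_congr rfl fun j _ => ?_
  rw [metricDeriv_comm, metricRep_comm g x₀ y k j, metricDeriv, Matrix.of_apply]
  ring

theorem curlMat_flat (hX : IsSmoothField X) (hy : y ∈ (extChartAt (𝓡 n) x₀).target) :
    curlMat (flat g X) x₀ y = metricDerivMul g X x₀ y + metricRep g x₀ y * jacobian X x₀ y -
      (metricDerivMul g X x₀ y + metricRep g x₀ y * jacobian X x₀ y)ᵀ := by
  have differentiableAt_X := (hX.contDiffAt hy).differentiableAt (by simp)
  have differentiableAt_flat := ((hX.flat g).contDiffAt hy).differentiableAt (by simp)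
  ext k i
  have removeNth_zero : (0 : Fin 2).removeNth ![stdVec (n := n) i, stdVec k] = fun _ => stdVec k :=
    funext fun l => by fin_cases l; rfl
  have removeNth_one : (1 : Fin 2).removeNth ![stdVec (n := n) i, stdVec k] = fun _ => stdVec i :=
    funext fun l => by fin_cases l; rfl
  rw [curlMat, Matrix.of_apply, extDeriv_apply differentiableAt_flat, Fin.sum_univ_two,
    removeNth_zero, removeNth_one, Matrix.sub_apply, Matrix.transpose_apply,
    ← fderiv_formRep_flat differentiableAt_X hy, ← fderiv_formRep_flat differentiableAt_X hy]
  simp [sub_eq_add_neg]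

/-- Koszul's formula `2 g(∇_Y X, Z) = (L_X g)(Y, Z) + dX^♭(Y, Z)`, in a chart. -/
theorem koszul (hX : IsSmoothField X) (hy : y ∈ (extChartAt (𝓡 n) x₀).target) :
    (2 : ℝ) • (metricRep g x₀ y * covMat g X x₀ y) =
      lieMat g X x₀ y + curlMat (flat g X) x₀ y := by
  rw [metricRep_mul_covMat ((hX.contDiffAt hy).differentiableAt (by simp)) hy, curlMat_flat hX hy,
    lieMat, Matrix.transpose_add, Matrix.transpose_mul, metricRep_transpose, two_smul]
  abel

theorem metricDeriv_eq_covMat_sub_jacobian (hX : IsSmoothField X)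
    (hy : y ∈ (extChartAt (𝓡 n) x₀).target) :
    metricDeriv g x₀ y (vecRep X x₀ y) =
      (covMat g X x₀ y - jacobian X x₀ y)ᵀ * metricRep g x₀ y +
        metricRep g x₀ y * (covMat g X x₀ y - jacobian X x₀ y) := by
  have koszul_transpose := congrArg Matrix.transpose (koszul (g := g) hX hy)
  rw [Matrix.transpose_smul, Matrix.transpose_mul, Matrix.transpose_add, metricRep_transpose,
    lieMat_transpose, curlMat_transpose] at koszul_transpose
  have lieMat_eq : lieMat g X x₀ y = (covMat g X x₀ y)ᵀ * metricRep g x₀ y +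
      metricRep g x₀ y * covMat g X x₀ y := by
    refine smul_right_injective _ (two_ne_zero (α := ℝ)) ?_
    dsimp only
    rw [smul_add, koszul_transpose, koszul hX hy, two_smul]
    abel
  rw [Matrix.transpose_sub, Matrix.sub_mul, Matrix.mul_sub, sub_add_sub_comm, ← lieMat_eq, lieMat]
  abel

theorem vecRep_transition (X : (x : M) → TangentSpace (𝓡 n) x)
    (hx₀ : x ∈ (extChartAt (𝓡 n) x₀).source) (hx₁ : x ∈ (extChartAt (𝓡 n) x₁).source) :
    vecRep X x₁ (transition x₀ x₁ (extChartAt (𝓡 n) x₀ x)) =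
      fderiv ℝ (transition x₀ x₁) (extChartAt (𝓡 n) x₀ x)
        (vecRep X x₀ (extChartAt (𝓡 n) x₀ x)) := by
  rw [transition_extChartAt hx₀, vecRep_extChartAt _ hx₁, vecRep_extChartAt _ hx₀,
    fderiv_transition hx₀ hx₁, ContinuousLinearMap.comp_apply, ofChart_toChart_apply hx₀]

theorem metricRep_transition (g : Metric n M) (hx₀ : x ∈ (extChartAt (𝓡 n) x₀).source)
    (hx₁ : x ∈ (extChartAt (𝓡 n) x₁).source) :
    metricRep g x₀ (extChartAt (𝓡 n) x₀ x) =
      (transitionMat x₀ x₁ (extChartAt (𝓡 n) x₀ x))ᵀ *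
        metricRep g x₁ (transition x₀ x₁ (extChartAt (𝓡 n) x₀ x)) *
        transitionMat x₀ x₁ (extChartAt (𝓡 n) x₀ x) := by
  rw [transitionMat, transition_extChartAt hx₀, metricRep_eq_transpose_mul g hx₀,
    metricRep_eq_transpose_mul g hx₁, ← ofChart_comp_fderiv_transition hx₀ hx₁, matOf_comp,
    Matrix.transpose_mul]
  simp only [Matrix.mul_assoc]

theorem curlMat_transition {θ : Form n M 1} (hθ : IsSmooth θ)
    (hx₀ : x ∈ (extChartAt (𝓡 n) x₀).source) (hx₁ : x ∈ (extChartAt (𝓡 n) x₁).source) :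
    curlMat θ x₀ (extChartAt (𝓡 n) x₀ x) =
      (transitionMat x₀ x₁ (extChartAt (𝓡 n) x₀ x))ᵀ *
        curlMat θ x₁ (extChartAt (𝓡 n) x₁ x) *
        transitionMat x₀ x₁ (extChartAt (𝓡 n) x₀ x) := by
  let B : Coord n →L[ℝ] Coord n →L[ℝ] ℝ :=
    ((ContinuousAlternatingMap.ofSubsingletonLIE (𝕜 := ℝ) (E := Coord n) (F := ℝ)
      (0 : Fin 1)).symm.toContinuousLinearEquiv : _ →L[ℝ] _) ∘L
        (extDeriv (formRep θ x₁) (extChartAt (𝓡 n) x₁ x)).curryLeft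
  have B_apply (v w : Coord n) :
      extDeriv (formRep θ x₁) (extChartAt (𝓡 n) x₁ x) ![v, w] = B v w :=
    congrArg _ (funext fun l => by fin_cases l <;> rfl)
  let L := fderiv ℝ (transition x₀ x₁) (extChartAt (𝓡 n) x₀ x)
  ext k i
  have map_pair : ⇑L ∘ ![stdVec i, stdVec k] = ![L (stdVec i), L (stdVec k)] :=
    funext fun l => by fin_cases l <;> rfl
  rw [curlMat, Matrix.of_apply, extDeriv_formRep_transition hθ hx₀ hx₁,
    ContinuousAlternatingMap.compContinuousLinearMap_apply, map_pair, B_apply, map_stdVec L i,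
    map_stdVec L k]
  simp only [_root_.map_sum, map_smul, _root_.sum_apply, _root_.smul_apply, smul_eq_mul,
    L, transitionMat, curlMat, Matrix.mul_apply, Matrix.transpose_apply, Matrix.of_apply, B_apply,
    Finset.mul_sum, Finset.sum_mul]
  rw [Finset.sum_comm]
  exact Finset.sum_congr rfl fun l _ => Finset.sum_congr rfl fun m _ => by ring

theorem hasDerivAt_matOf {L : ℝ → Coord n →L[ℝ] Coord n} {L' : Coord n →L[ℝ] Coord n} {t : ℝ}
    (hL : HasDerivAt L L' t) : HasDerivAt (fun s => matOf (L s)) (matOf L') t :=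
  hasDerivAt_matrix.2 fun i j => by
    simp only [matOf_apply]
    exact (EuclideanSpace.proj i : Coord n →L[ℝ] ℝ).hasFDerivAt.comp_hasDerivAt t
      ((ContinuousLinearMap.apply ℝ (Coord n) (stdVec j)).hasFDerivAt.comp_hasDerivAt t hL)

theorem differentiableAt_transition (hx₀ : x ∈ (extChartAt (𝓡 n) x₀).source)
    (hx₁ : x ∈ (extChartAt (𝓡 n) x₁).source) :
    DifferentiableAt ℝ (transition x₀ x₁) (extChartAt (𝓡 n) x₀ x) :=
  (contDiffAt_transition hx₀ hx₁).differentiableAt (by simp)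

theorem differentiableAt_fderiv_transition (hx₀ : x ∈ (extChartAt (𝓡 n) x₀).source)
    (hx₁ : x ∈ (extChartAt (𝓡 n) x₁).source) :
    DifferentiableAt ℝ (fderiv ℝ (transition x₀ x₁)) (extChartAt (𝓡 n) x₀ x) :=
  ((contDiffAt_transition hx₀ hx₁).fderiv_right (m := ∞) (by simp)).differentiableAt (by simp)

omit [IsManifold (𝓡 n) ∞ M] in
theorem transition_mem_target (hx₀ : x ∈ (extChartAt (𝓡 n) x₀).source)
    (hx₁ : x ∈ (extChartAt (𝓡 n) x₁).source) :
    transition x₀ x₁ (extChartAt (𝓡 n) x₀ x) ∈ (extChartAt (𝓡 n) x₁).target := by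
  rw [transition_extChartAt hx₀]
  exact (extChartAt (𝓡 n) x₁).map_source hx₁

open scoped Matrix.Norms.Operator in
theorem metricDeriv_transition (g : Metric n M) (hx₀ : x ∈ (extChartAt (𝓡 n) x₀).source)
    (hx₁ : x ∈ (extChartAt (𝓡 n) x₁).source) (hy : extChartAt (𝓡 n) x₀ x = y) (v : Coord n) :
    metricDeriv g x₀ y v =
      (transitionMatDeriv x₀ x₁ y v)ᵀ * metricRep g x₁ (transition x₀ x₁ y) *
          transitionMat x₀ x₁ y +
        (transitionMat x₀ x₁ y)ᵀ *
          metricDeriv g x₁ (transition x₀ x₁ y) (fderiv ℝ (transition x₀ x₁) y v) *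
          transitionMat x₀ x₁ y +
        (transitionMat x₀ x₁ y)ᵀ * metricRep g x₁ (transition x₀ x₁ y) *
          transitionMatDeriv x₀ x₁ y v := by
  obtain ⟨γ, rfl, hγ⟩ := exists_hasDerivAt y v
  have hasDerivAt_transition := (hy ▸ differentiableAt_transition hx₀ hx₁ :
    DifferentiableAt ℝ (transition x₀ x₁) (γ 0)).hasFDerivAt.comp_hasDerivAt 0 hγ
  have hasDerivAt_mat := hasDerivAt_matOf <| (hy ▸ differentiableAt_fderiv_transition hx₀ hx₁ :
    DifferentiableAt ℝ (fderiv ℝ (transition x₀ x₁)) (γ 0)).hasFDerivAt.comp_hasDerivAt 0 hγ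
  have hasDerivAt_transpose := hasDerivAt_matrix.2 fun i j => hasDerivAt_matrix.1 hasDerivAt_mat j i
  have hasDerivAt_product := (hasDerivAt_transpose.fun_mul (hasDerivAt_metricRep g
    hasDerivAt_transition (hy ▸ transition_mem_target hx₀ hx₁))).fun_mul hasDerivAt_mat
  have metricRep_eq : (fun t => metricRep g x₀ (γ t)) =ᶠ[𝓝 0] fun t =>
      (transitionMat x₀ x₁ (γ t))ᵀ * metricRep g x₁ (transition x₀ x₁ (γ t)) *
        transitionMat x₀ x₁ (γ t) := by
    filter_upwards [hγ.continuousAt.eventually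
      (hy ▸ eventually_exists_extChartAt_eq hx₀ hx₁)] with t ⟨z, hz₀, hz₁, hz⟩
    rw [← hz, metricRep_transition g hz₀ hz₁]
  have hasDerivAt_metric := hasDerivAt_metricRep g hγ
    (hy ▸ (extChartAt (𝓡 n) x₀).map_source hx₀ : γ 0 ∈ (extChartAt (𝓡 n) x₀).target)
  rw [hasDerivAt_metric.unique (hasDerivAt_product.congr_of_eventuallyEq metricRep_eq),
    Matrix.add_mul]
  rfl

theorem jacobian_transition (hX : IsSmoothField X) (hx₀ : x ∈ (extChartAt (𝓡 n) x₀).source)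
    (hx₁ : x ∈ (extChartAt (𝓡 n) x₁).source) (hy : extChartAt (𝓡 n) x₀ x = y) :
    jacobian X x₁ (transition x₀ x₁ y) * transitionMat x₀ x₁ y =
      transitionMatDeriv x₀ x₁ y (vecRep X x₀ y) + transitionMat x₀ x₁ y * jacobian X x₀ y := by
  subst hy
  set y := extChartAt (𝓡 n) x₀ x
  have hasFDerivAt_comp := ((hX.contDiffAt (transition_mem_target hx₀ hx₁)).differentiableAt
    (by simp)).hasFDerivAt.comp y (differentiableAt_transition hx₀ hx₁).hasFDerivAt
  have hasFDerivAt_apply := (differentiableAt_fderiv_transition hx₀ hx₁).hasFDerivAt.clm_apply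
    ((hX.contDiffAt ((extChartAt (𝓡 n) x₀).map_source hx₀)).differentiableAt
      (by simp)).hasFDerivAt
  have vecRep_eq : vecRep X x₁ ∘ transition x₀ x₁ =ᶠ[𝓝 y]
      fun z => fderiv ℝ (transition x₀ x₁) z (vecRep X x₀ z) := by
    filter_upwards [eventually_exists_extChartAt_eq hx₀ hx₁] with w ⟨z, hz₀, hz₁, hz⟩
    rw [← hz]
    exact vecRep_transition X hz₀ hz₁
  have second_symm : (fderiv ℝ (fderiv ℝ (transition x₀ x₁)) y).flip (vecRep X x₀ y) =
      fderiv ℝ (fderiv ℝ (transition x₀ x₁)) y (vecRep X x₀ y) := by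
    ext1 w
    exact ((contDiffAt_transition hx₀ hx₁).isSymmSndFDerivAt (by
      rw [minSmoothness_of_isRCLikeNormedField]; exact ENat.LEInfty.out)) w _
  have fderiv_eq := hasFDerivAt_comp.unique (hasFDerivAt_apply.congr_of_eventuallyEq vecRep_eq)
  rw [jacobian, jacobian, transitionMat, ← matOf_comp, fderiv_eq, second_symm, map_add, matOf_comp,
    add_comm, transitionMatDeriv]

theorem lieMat_transition (g : Metric n M) (hX : IsSmoothField X)
    (hx₀ : x ∈ (extChartAt (𝓡 n) x₀).source) (hx₁ : x ∈ (extChartAt (𝓡 n) x₁).source) :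
    lieMat g X x₀ (extChartAt (𝓡 n) x₀ x) =
      (transitionMat x₀ x₁ (extChartAt (𝓡 n) x₀ x))ᵀ *
        lieMat g X x₁ (extChartAt (𝓡 n) x₁ x) *
        transitionMat x₀ x₁ (extChartAt (𝓡 n) x₀ x) := by
  have jacobian_eq := jacobian_transition hX hx₀ hx₁ rfl
  have jacobian_transpose_eq := congrArg Matrix.transpose jacobian_eq
  rw [Matrix.transpose_mul, Matrix.transpose_add, Matrix.transpose_mul] at jacobian_transpose_eq
  rw [← transition_extChartAt (x₀ := x₀) (x₁ := x₁) hx₀, lieMat, lieMat,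
    metricDeriv_transition g hx₀ hx₁ rfl, metricRep_transition g hx₀ hx₁,
    vecRep_transition X hx₀ hx₁]
  set P := transitionMat x₀ x₁ (extChartAt (𝓡 n) x₀ x)
  have expand (D J₁ G₁ : Matrix (Fin n) (Fin n) ℝ) :
      Pᵀ * (D + J₁ᵀ * G₁ + G₁ * J₁) * P = Pᵀ * D * P + Pᵀ * J₁ᵀ * G₁ * P + Pᵀ * G₁ * (J₁ * P) := by
    noncomm_ring
  rw [expand, jacobian_transpose_eq, jacobian_eq]
  noncomm_ring

theorem metricRep_mul_covMat_transition (g : Metric n M) (hX : IsSmoothField X)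
    (hx₀ : x ∈ (extChartAt (𝓡 n) x₀).source) (hx₁ : x ∈ (extChartAt (𝓡 n) x₁).source) :
    metricRep g x₀ (extChartAt (𝓡 n) x₀ x) * covMat g X x₀ (extChartAt (𝓡 n) x₀ x) =
      (transitionMat x₀ x₁ (extChartAt (𝓡 n) x₀ x))ᵀ *
        (metricRep g x₁ (extChartAt (𝓡 n) x₁ x) * covMat g X x₁ (extChartAt (𝓡 n) x₁ x)) *
        transitionMat x₀ x₁ (extChartAt (𝓡 n) x₀ x) := by
  refine smul_right_injective _ (two_ne_zero (α := ℝ)) ?_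
  dsimp only
  rw [koszul hX ((extChartAt (𝓡 n) x₀).map_source hx₀), ← Matrix.smul_mul, ← Matrix.mul_smul,
    koszul hX ((extChartAt (𝓡 n) x₁).map_source hx₁), lieMat_transition g hX hx₀ hx₁,
    curlMat_transition (hX.flat g) hx₀ hx₁, Matrix.mul_add, Matrix.add_mul]

theorem covMat_conj (g : Metric n M) (hX : IsSmoothField X)
    (hx₀ : x ∈ (extChartAt (𝓡 n) x₀).source) :
    covMat g X x₀ (extChartAt (𝓡 n) x₀ x) = (matOf (ofChart x₀ x))⁻¹ *
      covMat g X x (extChartAt (𝓡 n) x x) * matOf (ofChart x₀ x) := by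
  have transition_eq :=
    metricRep_mul_covMat_transition g hX hx₀ (mem_extChartAt_source (I := 𝓡 n) x)
  rw [transitionMat, fderiv_transition hx₀ (mem_extChartAt_source (I := 𝓡 n) x), toChart_self,
    ContinuousLinearMap.id_comp, metricRep_self] at transition_eq
  have isUnit_det := isUnit_metricRep_det g ((extChartAt (𝓡 n) x₀).map_source hx₀)
  calc covMat g X x₀ (extChartAt (𝓡 n) x₀ x)
    _ = (metricRep g x₀ (extChartAt (𝓡 n) x₀ x))⁻¹ * ((matOf (ofChart x₀ x))ᵀ *
          (gram g x * covMat g X x (extChartAt (𝓡 n) x x)) * matOf (ofChart x₀ x)) := by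
        rw [← transition_eq, Matrix.nonsing_inv_mul_cancel_left _ _ isUnit_det]
    _ = (metricRep g x₀ (extChartAt (𝓡 n) x₀ x))⁻¹ * (metricRep g x₀ (extChartAt (𝓡 n) x₀ x) *
          ((matOf (ofChart x₀ x))⁻¹ * covMat g X x (extChartAt (𝓡 n) x x) *
            matOf (ofChart x₀ x))) := by
        rw [metricRep_eq_transpose_mul g hx₀]
        simp only [Matrix.mul_assoc,
          Matrix.mul_nonsing_inv_cancel_left _ _ (isUnit_matOf_ofChart hx₀)]
    _ = _ := Matrix.nonsing_inv_mul_cancel_left _ _ isUnit_det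

theorem divergence_eq_trace (g : Metric n M) (hX : IsSmoothField X)
    (hx₀ : x ∈ (extChartAt (𝓡 n) x₀).source) :
    divergence g X x = (covMat g X x₀ (extChartAt (𝓡 n) x₀ x)).trace := by
  rw [covMat_conj g hX hx₀, Matrix.trace_mul_comm, ← Matrix.mul_assoc,
    Matrix.mul_nonsing_inv _ (isUnit_matOf_ofChart hx₀), Matrix.one_mul]
  rfl

theorem gradNorm_self (g : Metric n M) (X : (x : M) → TangentSpace (𝓡 n) x) (x : M) :
    gradNorm g X x = √(hsSq (gram g x) (covMat g X x (extChartAt (𝓡 n) x x))) := by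
  rw [gradNorm, ← metricRep_self, hsSq, Matrix.mul_assoc, Matrix.mul_assoc]
  simp only [Matrix.trace, Matrix.diag_apply, Matrix.mul_apply, Matrix.transpose_apply,
    Finset.mul_sum]
  refine congrArg _ (Finset.sum_congr rfl fun i _ => Finset.sum_congr rfl fun j _ => ?_)
  rw [Finset.sum_comm]
  refine Finset.sum_congr rfl fun l _ => Finset.sum_congr rfl fun k _ => ?_
  rw [metricRep_comm g x _ k l]
  simp only [covDeriv, covMat, Matrix.of_apply]
  ring

theorem gradNorm_eq_sqrt_hsSq (g : Metric n M) (hX : IsSmoothField X)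
    (hx₀ : x ∈ (extChartAt (𝓡 n) x₀).source) :
    gradNorm g X x = √(hsSq (metricRep g x₀ (extChartAt (𝓡 n) x₀ x))
      (covMat g X x₀ (extChartAt (𝓡 n) x₀ x))) := by
  rw [covMat_conj g hX hx₀, metricRep_eq_transpose_mul g hx₀,
    hsSq_conj (isUnit_matOf_ofChart hx₀), gradNorm_self]

end Covariant

section SmoothFunctions

open scoped Topology

variable {n : ℕ} {M : Type*} [TopologicalSpace M] [ChartedSpace (EuclideanSpace ℝ (Fin n)) M]
  {f : M → ℝ} {X : (x : M) → TangentSpace (𝓡 n) x} {x₀ x : M} {y : Coord n}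

/-- A function on `M` is smooth if its expressions in the charts are smooth. -/
def IsSmoothFun (f : M → ℝ) : Prop :=
  ∀ x₀ : M, ContDiffOn ℝ ∞ (f ∘ (extChartAt (𝓡 n) x₀).symm) (extChartAt (𝓡 n) x₀).target

/-- The derivative `X f` of a function along a vector field. -/
def dirDeriv (X : (x : M) → TangentSpace (𝓡 n) x) (f : M → ℝ) (x : M) : ℝ :=
  fderiv ℝ (f ∘ (extChartAt (𝓡 n) x).symm) (extChartAt (𝓡 n) x x) (X x)

theorem continuous_of_charts (F : M → Coord n → ℝ)
    (hF : ∀ x₀, ContinuousOn (F x₀) (extChartAt (𝓡 n) x₀).target)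
    (hf : ∀ x₀, ∀ x ∈ (extChartAt (𝓡 n) x₀).source, f x = F x₀ (extChartAt (𝓡 n) x₀ x)) :
    Continuous f := by
  refine continuous_iff_continuousAt.2 fun x => ?_
  exact (((hF x).comp (continuousOn_extChartAt x) (extChartAt (𝓡 n) x).mapsTo).congr
    (hf x)).continuousAt (extChartAt_source_mem_nhds x)

theorem IsSmoothFun.differentiableAt (hf : IsSmoothFun (n := n) f)
    (hy : y ∈ (extChartAt (𝓡 n) x₀).target) :
    DifferentiableAt ℝ (f ∘ (extChartAt (𝓡 n) x₀).symm) y :=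
  ((hf x₀).contDiffAt ((isOpen_extChartAt_target x₀).mem_nhds hy)).differentiableAt (by simp)

theorem IsSmoothFun.continuous (hf : IsSmoothFun (n := n) f) : Continuous f :=
  continuous_of_charts _ (fun x₀ => (hf x₀).continuousOn) fun x₀ x hx => by
    rw [Function.comp_apply, (extChartAt (𝓡 n) x₀).left_inv hx]

variable [IsManifold (𝓡 n) ∞ M]

theorem formRep_self {p : ℕ} (σ : Form n M p) (x : M) :
    formRep σ x (extChartAt (𝓡 n) x x) = formAt σ x := by
  rw [formRep_extChartAt _ (mem_extChartAt_source x), ofChart_self]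
  rfl

theorem vecRep_self (X : (x : M) → TangentSpace (𝓡 n) x) (x : M) :
    vecRep X x (extChartAt (𝓡 n) x x) = vecAt X x := by
  rw [vecRep_extChartAt _ (mem_extChartAt_source x), toChart_self]
  rfl

theorem dirDeriv_chart (hf : IsSmoothFun (n := n) f) (X : (x : M) → TangentSpace (𝓡 n) x)
    (hx : x ∈ (extChartAt (𝓡 n) x₀).source) :
    dirDeriv X f x = fderiv ℝ (f ∘ (extChartAt (𝓡 n) x₀).symm) (extChartAt (𝓡 n) x₀ x)
      (vecRep X x₀ (extChartAt (𝓡 n) x₀ x)) := by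
  have mem_source := mem_extChartAt_source (I := 𝓡 n) x
  have comp_transition : f ∘ (extChartAt (𝓡 n) x₀).symm =ᶠ[𝓝 (extChartAt (𝓡 n) x₀ x)]
      (f ∘ (extChartAt (𝓡 n) x).symm) ∘ transition x₀ x := by
    filter_upwards [eventually_exists_extChartAt_eq hx mem_source] with y ⟨z, hz, hz', hzy⟩
    rw [← hzy, Function.comp_apply, Function.comp_apply, Function.comp_apply,
      transition_extChartAt hz, (extChartAt (𝓡 n) x₀).left_inv hz,
      (extChartAt (𝓡 n) x).left_inv hz']
  have differentiableAt_f := hf.differentiableAt (transition_mem_target hx mem_source)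
  rw [comp_transition.fderiv_eq,
    fderiv_comp _ differentiableAt_f (differentiableAt_transition hx mem_source),
    ContinuousLinearMap.comp_apply, ← vecRep_transition X hx mem_source, transition_extChartAt hx,
    vecRep_self]
  rfl

theorem IsSmoothFun.continuous_dirDeriv (hf : IsSmoothFun (n := n) f) (hX : IsSmoothField X) :
    Continuous (dirDeriv X f) :=
  continuous_of_charts _
    (fun x₀ => ((hf x₀).continuousOn_fderiv_of_isOpen (isOpen_extChartAt_target x₀)
      (by simp)).clm_apply (hX x₀).continuousOn)
    fun _ _ hx => dirDeriv_chart hf X hx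

variable {g : Metric n M}

theorem contDiffOn_covMat (g : Metric n M) (hX : IsSmoothField X) (x₀ : M) (k i : Fin n) :
    ContDiffOn ℝ ∞ (fun y => covMat g X x₀ y k i) (extChartAt (𝓡 n) x₀).target := by
  have contDiffOn_X := contDiffOn_euclidean.1 (hX x₀)
  have contDiffOn_fderiv {φ : Coord n → ℝ} (hφ : ContDiffOn ℝ ∞ φ (extChartAt (𝓡 n) x₀).target)
      (v : Coord n) : ContDiffOn ℝ ∞ (fun y => fderiv ℝ φ y v) (extChartAt (𝓡 n) x₀).target :=
    (hφ.fderiv_of_isOpen (isOpen_extChartAt_target x₀) (by simp)).clm_apply contDiffOn_const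
  have contDiffOn_partial (i j k : Fin n) := contDiffOn_fderiv (contDiffOn_metricRep g x₀ i j)
    (stdVec k)
  refine (contDiffOn_fderiv (contDiffOn_X k) _).add
    (ContDiffOn.sum fun j _ => ContDiffOn.mul ?_ (contDiffOn_X j))
  exact contDiffOn_const.mul (ContDiffOn.sum fun l _ => (contDiffOn_metricRep_inv g x₀ k l).mul
    (((contDiffOn_partial _ _ _).add (contDiffOn_partial _ _ _)).sub (contDiffOn_partial _ _ _)))

theorem continuousOn_covMat (g : Metric n M) (hX : IsSmoothField X) (x₀ : M) :
    ContinuousOn (covMat g X x₀) (extChartAt (𝓡 n) x₀).target :=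
  continuousOn_pi.2 fun k => continuousOn_pi.2 fun i => (contDiffOn_covMat g hX x₀ k i).continuousOn

theorem continuous_divergence (g : Metric n M) (hX : IsSmoothField X) :
    Continuous (divergence g X) :=
  continuous_of_charts (fun x₀ y => (covMat g X x₀ y).trace)
    (fun x₀ => (Continuous.matrix_trace continuous_id).comp_continuousOn
      (continuousOn_covMat g hX x₀))
    fun _ _ hx => divergence_eq_trace g hX hx

theorem continuousOn_hsSq {G S : Coord n → Matrix (Fin n) (Fin n) ℝ} {s : Set (Coord n)}
    (hG : ContinuousOn G s) (hG' : ContinuousOn (fun y => (G y)⁻¹) s) (hS : ContinuousOn S s) :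
    ContinuousOn (fun y => hsSq (G y) (S y)) s := by
  rw [continuousOn_iff_continuous_domRestrict] at hG hG' hS ⊢
  exact (((hG'.matrix_mul hS.matrix_transpose).matrix_mul hG).matrix_mul hS).matrix_trace

theorem continuous_gradNorm (g : Metric n M) (hX : IsSmoothField X) :
    Continuous (gradNorm g X) :=
  continuous_of_charts
    (fun x₀ y => √(hsSq (metricRep g x₀ y) (covMat g X x₀ y)))
    (fun x₀ => (continuousOn_hsSq
      (continuousOn_pi.2 fun i => continuousOn_pi.2 fun j =>
        (contDiffOn_metricRep g x₀ i j).continuousOn)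
      (continuousOn_pi.2 fun i => continuousOn_pi.2 fun j =>
        (contDiffOn_metricRep_inv g x₀ i j).continuousOn)
      (continuousOn_covMat g hX x₀)).sqrt)
    fun _ _ hx => gradNorm_eq_sqrt_hsSq g hX hx

end SmoothFunctions

section FormInner

open Matrix

variable {n p : ℕ} {M : Type*} [TopologicalSpace M] [ChartedSpace (EuclideanSpace ℝ (Fin n)) M]
  [IsManifold (𝓡 n) ∞ M] {x₀ x : M}

theorem formInner_eq (g : Metric n M) (α β : Form n M p) (x : M) :
    formInner g α β x =
      (p.factorial : ℝ)⁻¹ * contract (gram g x)⁻¹ (formAt α x) (formAt β x) := by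
  rw [contract_apply]
  rfl

theorem formInner_chart (g : Metric n M) (α β : Form n M p)
    (hx : x ∈ (extChartAt (𝓡 n) x₀).source) :
    formInner g α β x = (p.factorial : ℝ)⁻¹ *
      contract (metricRep g x₀ (extChartAt (𝓡 n) x₀ x))⁻¹ (formRep α x₀ (extChartAt (𝓡 n) x₀ x))
        (formRep β x₀ (extChartAt (𝓡 n) x₀ x)) := by
  have isUnit_det := isUnit_matOf_ofChart (n := n) hx
  have isUnit_det_transpose : IsUnit (matOf (n := n) (ofChart x₀ x))ᵀ.det := by
    rwa [Matrix.det_transpose]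
  rw [formInner_eq, formRep_extChartAt _ hx, formRep_extChartAt _ hx,
    ← contract_matOf_mul_mul_transpose, metricRep_eq_transpose_mul g hx, Matrix.mul_inv_rev,
    Matrix.mul_inv_rev, Matrix.mul_nonsing_inv_cancel_left _ _ isUnit_det,
    Matrix.nonsing_inv_mul_cancel_right _ _ isUnit_det_transpose]

theorem isSmoothFun_formInner (g : Metric n M) {α β : Form n M p} (hα : IsSmooth α)
    (hβ : IsSmooth β) : IsSmoothFun (n := n) (formInner g α β) := by
  intro x₀
  have contDiffOn_apply {σ : Form n M p} (hσ : IsSmooth σ) (v : Fin p → Coord n) :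
      ContDiffOn ℝ ∞ (fun y => formRep σ x₀ y v) (extChartAt (𝓡 n) x₀).target :=
    (ContinuousAlternatingMap.apply ℝ (Coord n) ℝ v).contDiff.comp_contDiffOn (hσ x₀)
  refine ContDiffOn.congr (f := fun y => (p.factorial : ℝ)⁻¹ *
    contract (metricRep g x₀ y)⁻¹ (formRep α x₀ y) (formRep β x₀ y)) ?_ fun y hy => ?_
  · simp only [contract_apply]
    exact contDiffOn_const.mul <| ContDiffOn.sum fun I _ => ContDiffOn.sum fun J _ =>
      ((contDiffOn_prod fun k _ => contDiffOn_metricRep_inv g x₀ _ _).mul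
        (contDiffOn_apply hα _)).mul (contDiffOn_apply hβ _)
  · rw [Function.comp_apply, formInner_chart g α β ((extChartAt (𝓡 n) x₀).map_target hy),
      (extChartAt (𝓡 n) x₀).right_inv hy]

theorem formInner_self_nonneg (g : Metric n M) (α : Form n M p) (x : M) :
    0 ≤ formInner g α α x := by
  rw [formInner_eq]
  exact mul_nonneg (by positivity) (contract_self_nonneg (gram_posDef g x).inv.posSemidef _)

theorem formInner_eq_zero_of_self {g : Metric n M} {α : Form n M p}
    (hα : formInner g α α x = 0) (β : Form n M p) : formInner g α β x = 0 := by
  rw [formInner_eq] at hα ⊢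
  have factorial_ne_zero : (p.factorial : ℝ)⁻¹ ≠ 0 := by positivity
  rw [contract_eq_zero_of_self (gram_posDef g x).inv.posSemidef
    ((mul_eq_zero.1 hα).resolve_left factorial_ne_zero), mul_zero]

theorem contract_gram_inv_comm (g : Metric n M) (x : M) (u w : (Fin p → Coord n) → ℝ) :
    contract (gram g x)⁻¹ u w = contract (gram g x)⁻¹ w u := by
  rw [contract_comm, Matrix.transpose_nonsing_inv, gram_transpose]

theorem formInner_comm (g : Metric n M) (α β : Form n M p) (x : M) :
    formInner g α β x = formInner g β α x := by
  rw [formInner_eq, formInner_eq, contract_gram_inv_comm]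

theorem formInner_add_left (g : Metric n M) (α β γ : Form n M p) (x : M) :
    formInner g (fun x => α x + β x) γ x = formInner g α γ x + formInner g β γ x := by
  rw [formInner_eq, formInner_eq, formInner_eq, ← mul_add, ← LinearMap.add_apply, ← map_add]
  rfl

theorem formInner_smul_left (g : Metric n M) (c : M → ℝ) (α β : Form n M p) (x : M) :
    formInner g (fun x => c x • α x) β x = c x * formInner g α β x := by
  rw [formInner_eq, formInner_eq, mul_left_comm, ← smul_eq_mul (c x), ← LinearMap.smul_apply,
    ← map_smul]
  rfl

theorem sharp_gram_inv_flat (g : Metric n M) (X : (x : M) → TangentSpace (𝓡 n) x) (x : M) :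
    sharp (gram g x)⁻¹ (formAt (flat g X) x) = vecAt X x := by
  rw [← vecRep_self, ← formRep_self, ← metricRep_self,
    ← vecRep_eq_sharp g X ((extChartAt (𝓡 n) x).map_source (mem_extChartAt_source x))]

theorem formInner_wedge_flat (g : Metric n M) (X : (x : M) → TangentSpace (𝓡 n) x)
    (β : Form n M p) (α : Form n M (p + 1)) (x : M) :
    formInner g (wedge (flat g X) β) α x = formInner g β (interiorMul X α) x := by
  have formAt_wedge :
      formAt (wedge (flat g X) β) x = wedgeCovector (formAt (flat g X) x) (formAt β x) := rfl
  have formAt_interiorMul : formAt (interiorMul X α) x = (formAt α x).curryLeft (vecAt X x) := rfl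
  rw [formInner_eq, formInner_eq, formAt_wedge, contract_wedgeCovector, sharp_gram_inv_flat,
    formAt_interiorMul, Nat.factorial_succ, Nat.cast_mul]
  push_cast
  field_simp

end FormInner

section LieDerivative

open scoped Topology Nat

variable {n p : ℕ} {M : Type*} [TopologicalSpace M] [ChartedSpace (EuclideanSpace ℝ (Fin n)) M]
  {X : (x : M) → TangentSpace (𝓡 n) x}

/-- The Lie derivative of a form along `X`, defined by Cartan's formula
`L_X = ι_X d + d ι_X`. -/
def lieDeriv (X : (x : M) → TangentSpace (𝓡 n) x) : {p : ℕ} → Form n M p → Form n M p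
  | 0, α => interiorMul X (extDer α)
  | _ + 1, α => fun x => interiorMul X (extDer α) x + extDer (interiorMul X α) x

theorem form_eq_zero_of_lt (hp : n < p) (α : Form n M p) : α = 0 :=
  funext fun _ => alternating_eq_zero_of_lt hp _

variable [IsManifold (𝓡 n) ∞ M] {g : Metric n M}

theorem extDer_self {σ : Form n M p} (hσ : IsSmooth σ) (x : M) :
    formAt (extDer σ) x = extDeriv (formRep σ x) (extChartAt (𝓡 n) x x) := by
  rw [← formRep_self, formRep_extDer hσ ((extChartAt (𝓡 n) x).map_source (mem_extChartAt_source x))]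

theorem lieDeriv_eq {α : Form n M p} (hα : IsSmooth α) (hX : IsSmoothField X) (x : M) :
    ⇑(formAt (lieDeriv X α) x) =
      fderiv ℝ (formRep α x) (extChartAt (𝓡 n) x x) (vecAt X x) +
        act (fderiv ℝ (vecRep X x) (extChartAt (𝓡 n) x x)) (formAt α x) := by
  have mem_target := (extChartAt (𝓡 n) x).map_source (mem_extChartAt_source (I := 𝓡 n) x)
  cases p with
  | zero =>
    have interior_extDer : formAt (lieDeriv X α) x = (formAt (extDer α) x).curryLeft (vecAt X x) :=
      rfl
    rw [interior_extDer, extDer_self hα, cartan_zero, act_fin_zero, add_zero]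
  | succ p =>
    have lieDeriv_apply : formAt (lieDeriv X α) x =
        (formAt (extDer α) x).curryLeft (vecAt X x) + formAt (extDer (interiorMul X α)) x := rfl
    have formRep_interior : formRep (interiorMul X α) x =ᶠ[𝓝 (extChartAt (𝓡 n) x x)]
        fun z => (formRep α x z).curryLeft (vecRep X x z) := by
      filter_upwards [(isOpen_extChartAt_target x).mem_nhds mem_target] with z hz
      exact formRep_interiorMul X α hz
    rw [lieDeriv_apply, extDer_self hα, extDer_self (hα.interiorMul hX),
      formRep_interior.extDeriv_eq, ← vecRep_self X, ← formRep_self α]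
    exact cartan ((hα.contDiffAt mem_target).differentiableAt (by simp))
      ((hX.contDiffAt mem_target).differentiableAt (by simp))

/-- The pairing `⟨∇X · α, α⟩`, where `∇X` acts on forms as a derivation; it is the defect between
`⟨L_X α, α⟩` and `⟨∇_X α, α⟩`. -/
def gradAction (g : Metric n M) (X : (x : M) → TangentSpace (𝓡 n) x) (α : Form n M p) (x : M) : ℝ :=
  (p ! : ℝ)⁻¹ * contract (gram g x)⁻¹
    (act (matOf.symm (covMat g X x (extChartAt (𝓡 n) x x))) (formAt α x)) (formAt α x)

theorem abs_gradAction_le (hX : IsSmoothField X) (α : Form n M p) (x : M) :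
    |gradAction g X α x| ≤ p * (gradNorm g X x * formInner g α α x) := by
  have gradNorm_eq := gradNorm_eq_sqrt_hsSq g hX (mem_extChartAt_source (I := 𝓡 n) x)
  rw [metricRep_self] at gradNorm_eq
  rw [gradAction, abs_mul, abs_of_nonneg (by positivity), formInner_eq, gradNorm_eq]
  refine (mul_le_mul_of_nonneg_left (abs_contract_act_le (gram_posDef g x) _ _)
    (by positivity)).trans_eq ?_
  rw [StarAlgEquiv.apply_symm_apply]
  ring

theorem hasDerivAt_metricRep_inv (hX : IsSmoothField X) {x₀ : M} {γ : ℝ → Coord n} {t : ℝ}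
    (hγ : HasDerivAt γ (vecRep X x₀ (γ t)) t) (hγt : γ t ∈ (extChartAt (𝓡 n) x₀).target) :
    HasDerivAt (fun s => (metricRep g x₀ (γ s))⁻¹)
      (-((covMat g X x₀ (γ t) - jacobian X x₀ (γ t)) * (metricRep g x₀ (γ t))⁻¹ +
        (metricRep g x₀ (γ t))⁻¹ * (covMat g X x₀ (γ t) - jacobian X x₀ (γ t)).transpose)) t :=
  hasDerivAt_inv_of_transpose_mul_add_mul
    (metricDeriv_eq_covMat_sub_jacobian (g := g) hX hγt ▸ hasDerivAt_metricRep g hγ hγt)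
    (isUnit_metricRep_det g hγt)

theorem dirDeriv_formInner_self {α : Form n M p} (hα : IsSmooth α) (hX : IsSmoothField X) (x : M) :
    dirDeriv X (formInner g α α) x = 2 * (p ! : ℝ)⁻¹ *
      (contract (gram g x)⁻¹ (fderiv ℝ (formRep α x) (extChartAt (𝓡 n) x x) (vecAt X x))
          (formAt α x) -
        contract (gram g x)⁻¹
          (act (matOf.symm (covMat g X x (extChartAt (𝓡 n) x x)) -
            fderiv ℝ (vecRep X x) (extChartAt (𝓡 n) x x)) (formAt α x)) (formAt α x)) := by
  set Γ := matOf.symm (covMat g X x (extChartAt (𝓡 n) x x)) -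
    fderiv ℝ (vecRep X x) (extChartAt (𝓡 n) x x) with Γ_def
  have matOf_Γ : matOf Γ = covMat g X x (extChartAt (𝓡 n) x x) -
      jacobian X x (extChartAt (𝓡 n) x x) := by
    rw [Γ_def, map_sub, StarAlgEquiv.apply_symm_apply, jacobian]
  have mem_target := (extChartAt (𝓡 n) x).map_source (mem_extChartAt_source (I := 𝓡 n) x)
  obtain ⟨γ, hγ0, hγ⟩ := exists_hasDerivAt (extChartAt (𝓡 n) x x) (vecAt X x)
  rw [← hγ0] at mem_target
  have hasDerivAt_inv := hasDerivAt_metricRep_inv (g := g) hX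
    (by rwa [hγ0, vecRep_self]) mem_target
  rw [hγ0, ← matOf_Γ, ← hγ0] at hasDerivAt_inv
  have hasDerivAt_form := ((hα.contDiffAt mem_target).differentiableAt
    (by simp)).hasFDerivAt.comp_hasDerivAt 0 hγ
  have hasDerivAt_inner :=
    (hasDerivAt_contract Γ hasDerivAt_inv hasDerivAt_form hasDerivAt_form).const_mul (p ! : ℝ)⁻¹
  have hasDerivAt_chart := ((isSmoothFun_formInner g hα hα).differentiableAt
    mem_target).hasFDerivAt.comp_hasDerivAt 0 hγ
  have inner_eq : (formInner g α α ∘ (extChartAt (𝓡 n) x).symm) ∘ γ =ᶠ[𝓝 0] fun t =>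
      (p ! : ℝ)⁻¹ * contract (metricRep g x (γ t))⁻¹ (formRep α x (γ t)) (formRep α x (γ t)) := by
    filter_upwards [hγ.continuousAt.eventually
      ((isOpen_extChartAt_target x).mem_nhds mem_target)] with t ht
    rw [Function.comp_apply, Function.comp_apply,
      formInner_chart g α α ((extChartAt (𝓡 n) x).map_target ht),
      (extChartAt (𝓡 n) x).right_inv ht]
  have derivs_eq := hasDerivAt_chart.unique (hasDerivAt_inner.congr_of_eventuallyEq inner_eq)
  rw [Function.comp_apply, hγ0, metricRep_self, formRep_self,
    contract_gram_inv_comm g x (formAt α x), contract_gram_inv_comm g x (formAt α x) (act _ _)]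
    at derivs_eq
  rw [dirDeriv]
  refine derivs_eq.trans ?_
  ring

theorem formInner_lieDeriv_self {α : Form n M p} (hα : IsSmooth α) (hX : IsSmoothField X) (x : M) :
    formInner g (lieDeriv X α) α x =
      2⁻¹ * dirDeriv X (formInner g α α) x + gradAction g X α x := by
  rw [formInner_eq, lieDeriv_eq hα hX, map_add, LinearMap.add_apply, dirDeriv_formInner_self hα hX,
    act_sub, map_sub, LinearMap.sub_apply, gradAction]
  ring

end LieDerivative

section TwistedCartan

variable {n p : ℕ} {M : Type*} [TopologicalSpace M] [ChartedSpace (EuclideanSpace ℝ (Fin n)) M]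
  [IsManifold (𝓡 n) ∞ M] (g : Metric n M) (X : (x : M) → TangentSpace (𝓡 n) x)

theorem interiorMul_twistedD_add (α : Form n M (p + 1)) (x : M) :
    interiorMul X (twistedD (flat g X) α) x + twistedD (flat g X) (interiorMul X α) x =
      lieDeriv X α x + g.inner x (X x) (X x) • α x := by
  have wedge_add : interiorMul X (wedge (flat g X) α) x + wedge (flat g X) (interiorMul X α) x =
      g.inner x (X x) (X x) • α x :=
    curryLeft_wedgeCovector_add (formAt (flat g X) x) (formAt α x) (vecAt X x)
  have interiorMul_add : interiorMul X (twistedD (flat g X) α) x =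
      interiorMul X (extDer α) x + interiorMul X (wedge (flat g X) α) x := rfl
  rw [← wedge_add, interiorMul_add]
  exact add_add_add_comm (interiorMul X (extDer α) x) _ _ _

theorem interiorMul_twistedD_zero (α : Form n M 0) (x : M) :
    interiorMul X (twistedD (flat g X) α) x =
      lieDeriv X α x + g.inner x (X x) (X x) • α x :=
  congrArg (interiorMul X (extDer α) x + ·)
    (curryLeft_wedgeCovector_zero (formAt (flat g X) x) (formAt α x) (vecAt X x))

end TwistedCartan

section Volume

open Matrix Set MeasureTheory

theorem det_eq_det_matOf {n : ℕ} (L : Coord n →L[ℝ] Coord n) : L.det = (matOf L).det :=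
  (LinearMap.det_toMatrix (EuclideanSpace.basisFun (Fin n) ℝ).toBasis
    (L : Coord n →ₗ[ℝ] Coord n)).symm

theorem sqrt_det_transpose_mul_mul {n : ℕ} (P G : Matrix (Fin n) (Fin n) ℝ) :
    √(Pᵀ * G * P).det = |P.det| * √G.det := by
  rw [Matrix.det_mul_right_comm, Matrix.det_mul, Matrix.det_mul, Matrix.det_transpose, ← sq,
    Real.sqrt_mul (sq_nonneg _), Real.sqrt_sq_eq_abs]

theorem measurableSet_inter_preimage {E F : Type*} [TopologicalSpace E] [MeasurableSpace E]
    [BorelSpace E] [TopologicalSpace F] [MeasurableSpace F] [BorelSpace F] {f : E → F} {s : Set E}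
    {t : Set F} (hf : ContinuousOn f s) (hs : MeasurableSet s) (ht : MeasurableSet t) :
    MeasurableSet (s ∩ f ⁻¹' t) := by
  rw [← Subtype.image_preimage_coe]
  exact hs.subtype_image ((continuousOn_iff_continuous_domRestrict.1 hf).measurable ht)

variable {n : ℕ} {M : Type*} [TopologicalSpace M] [ChartedSpace (EuclideanSpace ℝ (Fin n)) M]
  {x₀ x₁ : M} {A : Set M}

theorem measurableSet_target (x₀ : M) : MeasurableSet (extChartAt (𝓡 n) x₀).target :=
  (isOpen_extChartAt_target (I := 𝓡 n) x₀).measurableSet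

theorem image_transition (h₀ : A ⊆ (extChartAt (𝓡 n) x₀).source) :
    transition x₀ x₁ '' (extChartAt (𝓡 n) x₀ '' A) = extChartAt (𝓡 n) x₁ '' A := by
  rw [image_image]
  exact image_congr fun x hx => transition_extChartAt (h₀ hx)

theorem injOn_transition (h₀ : A ⊆ (extChartAt (𝓡 n) x₀).source)
    (h₁ : A ⊆ (extChartAt (𝓡 n) x₁).source) :
    InjOn (transition x₀ x₁) (extChartAt (𝓡 n) x₀ '' A) := by
  rintro _ ⟨x, hx, rfl⟩ _ ⟨x', hx', rfl⟩ transition_eq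
  rw [transition_extChartAt (h₀ hx), transition_extChartAt (h₀ hx')] at transition_eq
  rw [(extChartAt (𝓡 n) x₁).injOn (h₁ hx) (h₁ hx') transition_eq]

section Measurability

variable [MeasurableSpace M] [BorelSpace M]

theorem measurableSet_source (x₀ : M) : MeasurableSet (extChartAt (𝓡 n) x₀).source :=
  (isOpen_extChartAt_source (I := 𝓡 n) x₀).measurableSet

theorem measurableSet_target_inter_preimage (x₀ : M) (hA : MeasurableSet A) :
    MeasurableSet ((extChartAt (𝓡 n) x₀).target ∩ (extChartAt (𝓡 n) x₀).symm ⁻¹' A) :=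
  measurableSet_inter_preimage (continuousOn_extChartAt_symm x₀) (measurableSet_target x₀) hA

theorem measurableSet_image_extChartAt (hA : MeasurableSet A)
    (h₀ : A ⊆ (extChartAt (𝓡 n) x₀).source) : MeasurableSet (extChartAt (𝓡 n) x₀ '' A) := by
  rw [(extChartAt (𝓡 n) x₀).image_eq_target_inter_inv_preimage h₀]
  exact measurableSet_target_inter_preimage x₀ hA

end Measurability

variable [IsManifold (𝓡 n) ∞ M]

/-- The density `√(det g_{ij})` of the Riemannian volume in the chart around `x₀`. -/
def volumeDensity (g : Metric n M) (x₀ : M) (y : Coord n) : ℝ :=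
  √(metricRep g x₀ y).det

theorem volumeDensity_nonneg (g : Metric n M) (x₀ : M) (y : Coord n) : 0 ≤ volumeDensity g x₀ y :=
  Real.sqrt_nonneg _

theorem contDiffOn_volumeDensity (g : Metric n M) (x₀ : M) :
    ContDiffOn ℝ ∞ (volumeDensity g x₀) (extChartAt (𝓡 n) x₀).target :=
  (contDiffOn_matrix_det (contDiffOn_metricRep g x₀)).sqrt
    fun _ hy => (metricRep_posDef g hy).det_pos.ne'

theorem volumeDensity_transition (g : Metric n M) {x : M}
    (hx₀ : x ∈ (extChartAt (𝓡 n) x₀).source) (hx₁ : x ∈ (extChartAt (𝓡 n) x₁).source) :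
    volumeDensity g x₀ (extChartAt (𝓡 n) x₀ x) =
      |(fderiv ℝ (transition x₀ x₁) (extChartAt (𝓡 n) x₀ x)).det| *
        volumeDensity g x₁ (transition x₀ x₁ (extChartAt (𝓡 n) x₀ x)) := by
  rw [volumeDensity, metricRep_transition g hx₀ hx₁, sqrt_det_transpose_mul_mul, det_eq_det_matOf]
  rfl

variable [MeasurableSpace M]

theorem chartVolume_eq_map_withDensity (g : Metric n M) (x₀ : M) :
    chartVolume g x₀ = (((volume : Measure (Coord n)).restrict
      (extChartAt (𝓡 n) x₀).target).withDensity
        (fun y => ENNReal.ofReal (volumeDensity g x₀ y))).map (extChartAt (𝓡 n) x₀).symm :=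
  rfl

variable [BorelSpace M]

theorem aemeasurable_symm (g : Metric n M) (x₀ : M) :
    AEMeasurable (extChartAt (𝓡 n) x₀).symm
      (((volume : Measure (Coord n)).restrict (extChartAt (𝓡 n) x₀).target).withDensity
        (fun y => ENNReal.ofReal (volumeDensity g x₀ y))) :=
  ((continuousOn_extChartAt_symm x₀).aemeasurable (measurableSet_target x₀)).mono_ac
    (withDensity_absolutelyContinuous _ _)

theorem chartVolume_apply (g : Metric n M) (x₀ : M) (hA : MeasurableSet A) :
    chartVolume g x₀ A = ∫⁻ y in (extChartAt (𝓡 n) x₀).target ∩ (extChartAt (𝓡 n) x₀).symm ⁻¹' A,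
      ENNReal.ofReal (volumeDensity g x₀ y) := by
  rw [chartVolume_eq_map_withDensity, Measure.map_apply_of_aemeasurable (aemeasurable_symm g x₀) hA,
    withDensity_apply', Measure.restrict_restrict' (measurableSet_target x₀), inter_comm]

theorem chartVolume_apply_of_subset (g : Metric n M) (hA : MeasurableSet A)
    (h₀ : A ⊆ (extChartAt (𝓡 n) x₀).source) :
    chartVolume g x₀ A =
      ∫⁻ y in extChartAt (𝓡 n) x₀ '' A, ENNReal.ofReal (volumeDensity g x₀ y) := by
  rw [chartVolume_apply g x₀ hA, (extChartAt (𝓡 n) x₀).image_eq_target_inter_inv_preimage h₀]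

theorem chartVolume_compl_source (g : Metric n M) (x₀ : M) :
    chartVolume g x₀ (extChartAt (𝓡 n) x₀).sourceᶜ = 0 := by
  have target_inter : (extChartAt (𝓡 n) x₀).target ∩
      (extChartAt (𝓡 n) x₀).symm ⁻¹' (extChartAt (𝓡 n) x₀).sourceᶜ = ∅ :=
    eq_empty_of_forall_notMem fun _ hy => hy.2 ((extChartAt (𝓡 n) x₀).map_target hy.1)
  rw [chartVolume_apply g x₀ (measurableSet_source x₀).compl, target_inter, setLIntegral_empty]

theorem chartVolume_eq_of_subset (g : Metric n M) (hA : MeasurableSet A)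
    (h₀ : A ⊆ (extChartAt (𝓡 n) x₀).source) (h₁ : A ⊆ (extChartAt (𝓡 n) x₁).source) :
    chartVolume g x₁ A = chartVolume g x₀ A := by
  have image_measurable := measurableSet_image_extChartAt hA h₀
  have hasFDerivWithinAt_transition : ∀ y ∈ extChartAt (𝓡 n) x₀ '' A,
      HasFDerivWithinAt (transition x₀ x₁) (fderiv ℝ (transition x₀ x₁) y)
        (extChartAt (𝓡 n) x₀ '' A) y := by
    rintro _ ⟨x, hx, rfl⟩
    exact (differentiableAt_transition (h₀ hx) (h₁ hx)).hasFDerivAt.hasFDerivWithinAt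
  rw [chartVolume_apply_of_subset g hA h₁, chartVolume_apply_of_subset g hA h₀,
    ← image_transition h₀, lintegral_image_eq_lintegral_abs_det_fderiv_mul volume image_measurable
      hasFDerivWithinAt_transition (injOn_transition h₀ h₁)]
  refine setLIntegral_congr_fun image_measurable ?_
  rintro _ ⟨x, hx, rfl⟩
  simp only [volumeDensity_transition g (h₀ hx) (h₁ hx), ENNReal.ofReal_mul (abs_nonneg _)]

theorem chartVolume_restrict_source (g : Metric n M) (x₀ : M) :
    (chartVolume g x₀).restrict (extChartAt (𝓡 n) x₀).source = chartVolume g x₀ :=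
  Measure.restrict_eq_self_of_ae_mem (mem_ae_iff.2 (chartVolume_compl_source g x₀))

theorem chartVolume_le_restrict_source (g : Metric n M) (x₀ x₁ : M) :
    (chartVolume g x₁).restrict (extChartAt (𝓡 n) x₀).source ≤ chartVolume g x₀ := by
  refine Measure.le_iff.2 fun A hA => ?_
  have source_inter_measurable := (measurableSet_source (n := n) x₀).inter
    (measurableSet_source (n := n) x₁)
  rw [Measure.restrict_apply hA, ← chartVolume_restrict_source g x₁,
    Measure.restrict_apply (hA.inter (measurableSet_source x₀)), inter_assoc,
    chartVolume_eq_of_subset g (hA.inter source_inter_measurable)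
      (fun _ hx => hx.2.1) fun _ hx => hx.2.2]
  exact measure_mono inter_subset_left

theorem riemannianVolume_restrict_source (g : Metric n M) (x₀ : M) :
    (riemannianVolume g).restrict (extChartAt (𝓡 n) x₀).source = chartVolume g x₀ := by
  set S := (extChartAt (𝓡 n) x₀).source
  have hS : MeasurableSet S := measurableSet_source x₀
  have volume_le : riemannianVolume g ≤ chartVolume g x₀ + (riemannianVolume g).restrict Sᶜ := by
    refine iSup_le fun x₁ => ?_
    rw [← Measure.restrict_add_restrict_compl (μ := chartVolume g x₁) hS]
    exact add_le_add (chartVolume_le_restrict_source g x₀ x₁)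
      (Measure.restrict_mono le_rfl (le_iSup (chartVolume g) x₁))
  refine le_antisymm ((Measure.restrict_mono le_rfl volume_le).trans_eq ?_) ?_
  · rw [Measure.restrict_add, chartVolume_restrict_source, Measure.restrict_restrict hS,
      inter_compl_self, Measure.restrict_empty, add_zero]
  · rw [← chartVolume_restrict_source]
    exact Measure.restrict_mono le_rfl (le_iSup (chartVolume g) x₀)

theorem isLocallyFiniteMeasure_riemannianVolume (g : Metric n M) :
    IsLocallyFiniteMeasure (riemannianVolume g) := by
  refine ⟨fun x => ?_⟩
  have mem_source := mem_extChartAt_source (I := 𝓡 n) x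
  obtain ⟨K, hKx, hKt, hK⟩ := local_compact_nhds (extChartAt_target_mem_nhds (I := 𝓡 n) x)
  set U := (extChartAt (𝓡 n) x).source ∩ extChartAt (𝓡 n) x ⁻¹' interior K
  have hUs : U ⊆ (extChartAt (𝓡 n) x).source := inter_subset_left
  have hUo : IsOpen U := isOpen_extChartAt_preimage' x isOpen_interior
  refine ⟨U, hUo.mem_nhds ⟨mem_source, mem_interior_iff_mem_nhds.2 hKx⟩, ?_⟩
  have image_subset : extChartAt (𝓡 n) x '' U ⊆ K := by
    rintro _ ⟨z, hz, rfl⟩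
    exact interior_subset hz.2
  rw [← Measure.restrict_eq_self _ hUs, riemannianVolume_restrict_source,
    chartVolume_apply_of_subset g hUo.measurableSet hUs]
  exact (lintegral_mono_set image_subset).trans_lt
    (((contDiffOn_volumeDensity g x).continuousOn.mono hKt).integrableOn_compact
      hK).setLIntegral_lt_top

theorem integrable_of_continuous [CompactSpace M] (g : Metric n M) {f : M → ℝ}
    (hf : Continuous f) : Integrable f (riemannianVolume g) :=
  have := isLocallyFiniteMeasure_riemannianVolume g
  hf.integrable_of_hasCompactSupport (HasCompactSupport.of_compactSpace f)

theorem integral_eq_integral_chart (g : Metric n M) {f : M → ℝ} (hf : Continuous f)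
    (h0 : ∀ x ∉ (extChartAt (𝓡 n) x₀).source, f x = 0) :
    ∫ x, f x ∂riemannianVolume g = ∫ y in (extChartAt (𝓡 n) x₀).target,
      volumeDensity g x₀ y * f ((extChartAt (𝓡 n) x₀).symm y) := by
  have density_measurable : AEMeasurable (fun y => ENNReal.ofReal (volumeDensity g x₀ y))
      ((volume : Measure (Coord n)).restrict (extChartAt (𝓡 n) x₀).target) :=
    ((contDiffOn_volumeDensity g x₀).continuousOn.aemeasurable
      (measurableSet_target x₀)).ennreal_ofReal
  rw [← setIntegral_eq_integral_of_forall_compl_eq_zero h0, riemannianVolume_restrict_source,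
    chartVolume_eq_map_withDensity,
    integral_map (aemeasurable_symm g x₀) hf.aestronglyMeasurable,
    integral_withDensity_eq_integral_toReal_smul₀ density_measurable
      (ae_of_all _ fun _ => ENNReal.ofReal_lt_top)]
  simp only [ENNReal.toReal_ofReal (volumeDensity_nonneg g x₀ _), smul_eq_mul]

end Volume

section EuclideanDivergence

open MeasureTheory Set
open scoped Topology

theorem contDiff_indicator_of_isOpen {E F : Type*} [NormedAddCommGroup E] [NormedSpace ℝ E]
    [NormedAddCommGroup F] [NormedSpace ℝ F] {V : E → F} {T K : Set E} {r : WithTop ℕ∞}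
    (hV : ContDiffOn ℝ r V T) (hT : IsOpen T) (hK : IsClosed K) (hKT : K ⊆ T)
    (hVK : ∀ y ∈ T, y ∉ K → V y = 0) : ContDiff ℝ r (T.indicator V) := by
  have tsupport_subset : tsupport (T.indicator V) ⊆ K := by
    refine closure_minimal (Function.support_subset_iff'.2 fun y hy => ?_) hK
    by_cases hyT : y ∈ T
    · rw [indicator_of_mem hyT, hVK y hyT hy]
    · exact indicator_of_notMem hyT _
  refine contMDiff_iff_contDiff.1 (contMDiff_of_tsupport fun y hy => ?_)
  have hTy := hT.mem_nhds (hKT (tsupport_subset hy))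
  exact contMDiffAt_iff_contDiffAt.2 ((hV.contDiffAt hTy).congr_of_eventuallyEq
    (eqOn_indicator.eventuallyEq_of_mem hTy))

variable {n : ℕ}

theorem trace_matOf_smulRight (L : Coord n →L[ℝ] ℝ) (v : Coord n) :
    (matOf (L.smulRight v)).trace = L v := by
  conv_rhs => rw [← sum_smul_stdVec v, map_sum]
  simp only [Matrix.trace, Matrix.diag_apply, matOf_apply, ContinuousLinearMap.smulRight_apply,
    PiLp.smul_apply, map_smul, smul_eq_mul, mul_comm]

theorem trace_fderiv_smul {ρ : Coord n → ℝ} {V : Coord n → Coord n} {y : Coord n}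
    (hρ : DifferentiableAt ℝ ρ y) (hV : DifferentiableAt ℝ V y) :
    (matOf (fderiv ℝ (fun z => ρ z • V z) y)).trace =
      ρ y * (matOf (fderiv ℝ V y)).trace + fderiv ℝ ρ y (V y) := by
  rw [fderiv_fun_smul hρ hV, map_add, map_smul, Matrix.trace_add, Matrix.trace_smul,
    trace_matOf_smulRight, smul_eq_mul]

theorem integral_trace_fderiv_eq_zero {V : Coord n → Coord n} (hV : ContDiff ℝ 1 V)
    (hc : HasCompactSupport V) : ∫ y, (matOf (fderiv ℝ V y)).trace = 0 := by
  have trace_eq (y : Coord n) : (matOf (fderiv ℝ V y)).trace =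
      ∑ i, fderiv ℝ (fun z => V z i) y (stdVec i) := by
    refine Finset.sum_congr rfl fun i _ => ?_
    have hasFDerivAt_V := (hV.differentiable one_ne_zero y).hasFDerivAt
    have hasFDerivAt_i := (EuclideanSpace.proj i : Coord n →L[ℝ] ℝ).hasFDerivAt.comp y hasFDerivAt_V
    rw [Matrix.diag_apply, matOf_apply, show (fun z => V z i) = EuclideanSpace.proj i ∘ V from rfl,
      hasFDerivAt_i.fderiv]
    rfl
  have contDiff_comp (i : Fin n) : ContDiff ℝ 1 (fun z => V z i) := contDiff_euclidean.1 hV i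
  have hasCompactSupport_comp (i : Fin n) : HasCompactSupport (fun z => V z i) :=
    hc.comp_left (g := fun w : Coord n => w i) rfl
  simp only [trace_eq]
  rw [integral_finsetSum _ fun i _ => Continuous.integrable_of_hasCompactSupport
    (((contDiff_comp i).continuous_fderiv one_ne_zero).clm_apply continuous_const)
    ((hasCompactSupport_comp i).fderiv_apply ℝ _)]
  exact Finset.sum_eq_zero fun i _ =>
    integral_fderiv_eq_zero (contDiff_comp i) (hasCompactSupport_comp i) _

theorem setIntegral_trace_fderiv_eq_zero {V : Coord n → Coord n} {T K : Set (Coord n)}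
    (hV : ContDiffOn ℝ 1 V T) (hT : IsOpen T) (hK : IsCompact K) (hKT : K ⊆ T)
    (hVK : ∀ y ∈ T, y ∉ K → V y = 0) : ∫ y in T, (matOf (fderiv ℝ V y)).trace = 0 := by
  have support_subset : ∀ y ∉ K, T.indicator V y = 0 := fun y hy => by
    by_cases hyT : y ∈ T
    · rw [indicator_of_mem hyT, hVK y hyT hy]
    · exact indicator_of_notMem hyT _
  rw [← integral_trace_fderiv_eq_zero (contDiff_indicator_of_isOpen hV hT hK.isClosed hKT hVK)
    (HasCompactSupport.intro hK support_subset), ← integral_indicator hT.measurableSet]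
  congr 1 with y
  by_cases hyT : y ∈ T
  · rw [indicator_of_mem hyT,
      (eqOn_indicator.eventuallyEq_of_mem (hT.mem_nhds hyT)).fderiv_eq]
  · have eventually_zero : T.indicator V =ᶠ[𝓝 y] fun _ => 0 :=
      Filter.mem_of_superset (hK.isClosed.isOpen_compl.mem_nhds fun hyK => hyT (hKT hyK))
        support_subset
    rw [indicator_of_notMem hyT, eventually_zero.fderiv_eq, fderiv_fun_const, Pi.zero_apply,
      map_zero, Matrix.trace_zero]

end EuclideanDivergence

section Divergence

open Filter Set MeasureTheory
open scoped Topology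

variable {n : ℕ} {M : Type*} [TopologicalSpace M] [ChartedSpace (EuclideanSpace ℝ (Fin n)) M]
  {X : (x : M) → TangentSpace (𝓡 n) x} {f : M → ℝ} {x₀ x : M} {y : Coord n}

theorem IsSmoothFun.mul {h : M → ℝ} (hf : IsSmoothFun (n := n) f) (hh : IsSmoothFun (n := n) h) :
    IsSmoothFun (n := n) (fun x => f x * h x) := fun x₀ =>
  (hf x₀).mul (hh x₀)

theorem dirDeriv_sum {ι : Type*} (s : Finset ι) {f : ι → M → ℝ}
    (hf : ∀ i ∈ s, IsSmoothFun (n := n) (f i)) (x : M) :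
    dirDeriv X (fun x => ∑ i ∈ s, f i x) x = ∑ i ∈ s, dirDeriv X (f i) x := by
  have fderiv_sum := fderiv_fun_sum fun i hi =>
    (hf i hi).differentiableAt (mem_extChartAt_target (I := 𝓡 n) x)
  exact (congrArg (fun L : Coord n →L[ℝ] ℝ => L (vecAt X x)) fderiv_sum).trans
    (_root_.sum_apply _ _ _)

theorem dirDeriv_eq_zero_of_notMem_tsupport (X : (x : M) → TangentSpace (𝓡 n) x)
    (hx : x ∉ tsupport f) : dirDeriv X f x = 0 := by
  have tendsto_symm : Tendsto (extChartAt (𝓡 n) x).symm (𝓝 (extChartAt (𝓡 n) x x)) (𝓝 x) := by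
    simpa only [ContinuousAt, extChartAt_to_inv] using continuousAt_extChartAt_symm (I := 𝓡 n) x
  have eventually_zero : f ∘ (extChartAt (𝓡 n) x).symm =ᶠ[𝓝 (extChartAt (𝓡 n) x x)] fun _ => 0 :=
    tendsto_symm.eventually (notMem_tsupport_iff_eventuallyEq.1 hx)
  rw [dirDeriv, eventually_zero.fderiv_eq, fderiv_fun_const]
  rfl

variable [IsManifold (𝓡 n) ∞ M]

theorem isSmoothFun_of_contMDiff (hf : ContMDiff (𝓡 n) 𝓘(ℝ, ℝ) ∞ f) : IsSmoothFun (n := n) f :=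
  fun x₀ => contMDiffOn_iff_contDiffOn.1 (hf.comp_contMDiffOn (contMDiffOn_extChartAt_symm x₀))

theorem exists_finite_partition_of_unity (n : ℕ) (M : Type*) [TopologicalSpace M]
    [ChartedSpace (EuclideanSpace ℝ (Fin n)) M] [IsManifold (𝓡 n) ∞ M] [CompactSpace M]
    [T2Space M] :
    ∃ (s : Finset M) (ρ : M → M → ℝ), (∀ i, IsSmoothFun (n := n) (ρ i)) ∧
      (∀ i, tsupport (ρ i) ⊆ (extChartAt (𝓡 n) i).source) ∧ ∀ x, ∑ i ∈ s, ρ i x = 1 := by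
  obtain ⟨ρ, hρ⟩ := SmoothPartitionOfUnity.exists_isSubordinate_chartAt_source (𝓡 n) M
  have finite_nonempty := ρ.locallyFinite.finite_nonempty_of_compact
  refine ⟨finite_nonempty.toFinset, fun i => ρ i,
    fun i => isSmoothFun_of_contMDiff (ρ i).contMDiff,
    fun i => (extChartAt_source (𝓡 n) i).symm ▸ hρ i, fun x => ?_⟩
  rw [← ρ.sum_eq_one (mem_univ x)]
  refine (finsum_eq_sum_of_support_subset _ fun i hi => ?_).symm
  exact finite_nonempty.mem_toFinset.2 ⟨x, hi⟩

theorem fderiv_volumeDensity (g : Metric n M) (hX : IsSmoothField X)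
    (hy : y ∈ (extChartAt (𝓡 n) x₀).target) :
    fderiv ℝ (volumeDensity g x₀) y (vecRep X x₀ y) =
      volumeDensity g x₀ y * (covMat g X x₀ y - jacobian X x₀ y).trace := by
  obtain ⟨γ, rfl, hγ⟩ := exists_hasDerivAt y (vecRep X x₀ y)
  have hasDerivAt_density := hasDerivAt_sqrt_det
    (metricDeriv_eq_covMat_sub_jacobian (g := g) hX hy ▸ hasDerivAt_metricRep g hγ hy)
    (metricRep_posDef g hy).det_pos
  have differentiableAt_density := ((contDiffOn_volumeDensity g x₀).contDiffAt
    ((isOpen_extChartAt_target x₀).mem_nhds hy)).differentiableAt (by simp)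
  exact (differentiableAt_density.hasFDerivAt.comp_hasDerivAt 0 hγ).unique hasDerivAt_density

theorem trace_fderiv_density_smul (g : Metric n M) (hX : IsSmoothField X) {f : Coord n → ℝ}
    (hf : DifferentiableAt ℝ f y) (hy : y ∈ (extChartAt (𝓡 n) x₀).target) :
    (matOf (fderiv ℝ (fun z => (volumeDensity g x₀ z * f z) • vecRep X x₀ z) y)).trace =
      volumeDensity g x₀ y *
        (fderiv ℝ f y (vecRep X x₀ y) + f y * (covMat g X x₀ y).trace) := by
  have differentiableAt_density := ((contDiffOn_volumeDensity g x₀).contDiffAt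
    ((isOpen_extChartAt_target x₀).mem_nhds hy)).differentiableAt (by simp)
  rw [trace_fderiv_smul (differentiableAt_density.fun_mul hf)
    ((hX.contDiffAt hy).differentiableAt (by simp)), fderiv_fun_mul differentiableAt_density hf,
    _root_.add_apply, _root_.smul_apply, _root_.smul_apply, fderiv_volumeDensity g hX hy,
    Matrix.trace_sub, ← jacobian, smul_eq_mul, smul_eq_mul]
  ring

variable [CompactSpace M] [MeasurableSpace M] [BorelSpace M]

theorem integral_dirDeriv_add_of_tsupport_subset (g : Metric n M) (hX : IsSmoothField X)
    (hf : IsSmoothFun (n := n) f) (hs : tsupport f ⊆ (extChartAt (𝓡 n) x₀).source) :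
    ∫ x, (dirDeriv X f x + f x * divergence g X x) ∂riemannianVolume g = 0 := by
  have isCompact_image : IsCompact (extChartAt (𝓡 n) x₀ '' tsupport f) :=
    (isClosed_tsupport f).isCompact.image_of_continuousOn ((continuousOn_extChartAt x₀).mono hs)
  have image_subset : extChartAt (𝓡 n) x₀ '' tsupport f ⊆ (extChartAt (𝓡 n) x₀).target :=
    image_subset_iff.2 fun _ hx => (extChartAt (𝓡 n) x₀).map_source (hs hx)
  have f_symm_eq_zero : ∀ y ∈ (extChartAt (𝓡 n) x₀).target,
      y ∉ extChartAt (𝓡 n) x₀ '' tsupport f → f ((extChartAt (𝓡 n) x₀).symm y) = 0 :=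
    fun y hy hyK => image_eq_zero_of_notMem_tsupport fun hx =>
      hyK ⟨_, hx, (extChartAt (𝓡 n) x₀).right_inv hy⟩
  have chart_integral := setIntegral_trace_fderiv_eq_zero
    (V := fun y => (volumeDensity g x₀ y * (f ∘ (extChartAt (𝓡 n) x₀).symm) y) • vecRep X x₀ y)
    (((((contDiffOn_volumeDensity g x₀).mul (hf x₀)).smul (hX x₀))).of_le (by simp))
    (isOpen_extChartAt_target x₀) isCompact_image image_subset
    fun y hy hyK => by
      rw [Function.comp_apply, f_symm_eq_zero y hy hyK, mul_zero, zero_smul]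
  have continuous_integrand : Continuous fun x => dirDeriv X f x + f x * divergence g X x :=
    (hf.continuous_dirDeriv hX).add (hf.continuous.mul (continuous_divergence g hX))
  rw [integral_eq_integral_chart g continuous_integrand fun x hx => ?_, ← chart_integral]
  · refine setIntegral_congr_fun (measurableSet_target x₀) fun y hy => ?_
    have hx := (extChartAt (𝓡 n) x₀).map_target hy
    rw [trace_fderiv_density_smul g hX (hf.differentiableAt hy) hy]
    simp only [dirDeriv_chart hf X hx, divergence_eq_trace g hX hx,
      (extChartAt (𝓡 n) x₀).right_inv hy, Function.comp_apply]
  · have hx' : x ∉ tsupport f := fun h => hx (hs h)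
    rw [dirDeriv_eq_zero_of_notMem_tsupport X hx', image_eq_zero_of_notMem_tsupport hx', zero_mul,
      add_zero]

theorem integral_dirDeriv_add [T2Space M] (g : Metric n M) (hX : IsSmoothField X)
    (hf : IsSmoothFun (n := n) f) :
    ∫ x, (dirDeriv X f x + f x * divergence g X x) ∂riemannianVolume g = 0 := by
  obtain ⟨s, ρ, hρ, hρs, sum_eq_one⟩ := exists_finite_partition_of_unity n M
  have hρf (i : M) : IsSmoothFun (n := n) (fun x => ρ i x * f x) := (hρ i).mul hf
  have f_eq_sum : f = fun x => ∑ i ∈ s, ρ i x * f x := funext fun x => by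
    rw [← Finset.sum_mul, sum_eq_one, one_mul]
  have integrand_eq_sum (x : M) : dirDeriv X f x + f x * divergence g X x =
      ∑ i ∈ s, (dirDeriv X (fun x => ρ i x * f x) x + ρ i x * f x * divergence g X x) := by
    rw [Finset.sum_add_distrib, ← dirDeriv_sum s (fun i _ => hρf i), ← Finset.sum_mul, ← f_eq_sum,
      ← congrFun f_eq_sum x]
  have integrable_summand (i : M) : Integrable (fun x => dirDeriv X (fun x => ρ i x * f x) x +
      ρ i x * f x * divergence g X x) (riemannianVolume g) :=
    integrable_of_continuous g (((hρf i).continuous_dirDeriv hX).add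
      ((hρf i).continuous.mul (continuous_divergence g hX)))
  simp only [integrand_eq_sum]
  rw [integral_finsetSum _ fun i _ => integrable_summand i]
  exact Finset.sum_eq_zero fun i _ => integral_dirDeriv_add_of_tsupport_subset g hX (hρf i)
    (tsupport_mul_subset_left.trans (hρs i))

end Divergence

section Harmonic

open MeasureTheory

variable {n p : ℕ} {M : Type*} [TopologicalSpace M] [ChartedSpace (EuclideanSpace ℝ (Fin n)) M]
  [IsManifold (𝓡 n) ∞ M] {g : Metric n M} {θ : Form n M 1}
  {X : (x : M) → TangentSpace (𝓡 n) x}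

theorem IsSmooth.lieDeriv {α : Form n M p} (hα : IsSmooth α) (hX : IsSmoothField X) :
    IsSmooth (lieDeriv X α) := by
  cases p with
  | zero => exact hα.extDer.interiorMul hX
  | succ p => exact (hα.extDer.interiorMul hX).add (hα.interiorMul hX).extDer

theorem formInner_zero_left (g : Metric n M) (α : Form n M p) (x : M) :
    formInner g (fun _ => 0) α x = 0 :=
  formInner_eq_zero_of_self (by simp [formInner]) α

theorem formInner_zero_right (g : Metric n M) (α : Form n M p) (x : M) :
    formInner g α (fun _ => 0) x = 0 := by
  rw [formInner_comm, formInner_zero_left]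

theorem formInner_interiorMul_eq_zero {β : Form n M (p + 1)} {x : M}
    (hβ : formInner g β β x = 0) (X : (x : M) → TangentSpace (𝓡 n) x) (α : Form n M p) :
    formInner g (interiorMul X β) α x = 0 := by
  rw [formInner_comm, ← formInner_wedge_flat, formInner_comm, formInner_eq_zero_of_self hβ]

theorem abs_gradAction_le_dim (hX : IsSmoothField X) (α : Form n M p) (x : M) :
    |gradAction g X α x| ≤ n * (gradNorm g X x * formInner g α α x) := by
  refine (abs_gradAction_le hX α x).trans ?_
  have norm_nonneg : 0 ≤ gradNorm g X x * formInner g α α x :=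
    mul_nonneg (Real.sqrt_nonneg _) (formInner_self_nonneg g α x)
  rcases le_or_gt p n with hp | hp
  · gcongr
  · have formInner_eq_zero : formInner g α α x = 0 := by
      rw [form_eq_zero_of_lt hp α]
      exact formInner_zero_left g _ x
    rw [formInner_eq_zero, mul_zero, mul_zero, mul_zero]

theorem abs_gradAction_sub_le (hX : IsSmoothField X) (α : Form n M p) (x : M) :
    |gradAction g X α x - 2⁻¹ * (formInner g α α x * divergence g X x)| ≤
      (n + 1) * ((gradNorm g X x + |divergence g X x|) * formInner g α α x) := by
  have self_nonneg := formInner_self_nonneg g α x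
  have grad_nonneg : 0 ≤ gradNorm g X x * formInner g α α x :=
    mul_nonneg (Real.sqrt_nonneg _) self_nonneg
  have div_nonneg : 0 ≤ |divergence g X x| * formInner g α α x :=
    mul_nonneg (abs_nonneg _) self_nonneg
  have n_div_nonneg := mul_nonneg n.cast_nonneg div_nonneg
  calc |gradAction g X α x - 2⁻¹ * (formInner g α α x * divergence g X x)|
      ≤ |gradAction g X α x| + |2⁻¹ * (formInner g α α x * divergence g X x)| := abs_sub _ _
    _ ≤ n * (gradNorm g X x * formInner g α α x) +
          2⁻¹ * (|divergence g X x| * formInner g α α x) := by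
        rw [abs_mul, abs_mul, abs_of_nonneg self_nonneg, abs_of_pos (by norm_num : (0 : ℝ) < 2⁻¹),
          mul_comm (formInner g α α x)]
        gcongr
        exact abs_gradAction_le_dim hX α x
    _ ≤ (n + 1) * ((gradNorm g X x + |divergence g X x|) * formInner g α α x) := by linarith

theorem norm_mul_formInner_zero (g : Metric n M) (X : (x : M) → TangentSpace (𝓡 n) x)
    (α : Form n M 0) (x : M) :
    g.inner x (X x) (X x) * formInner g α α x =
      formInner g (interiorMul X (twistedD (flat g X) α)) α x - formInner g (lieDeriv X α) α x := by
  rw [eq_sub_iff_add_eq', ← formInner_smul_left g (fun x => g.inner x (X x) (X x)),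
    ← formInner_add_left, ← funext (interiorMul_twistedD_zero g X α)]

theorem norm_mul_formInner_succ (g : Metric n M) (X : (x : M) → TangentSpace (𝓡 n) x)
    (α : Form n M (p + 1)) (x : M) :
    g.inner x (X x) (X x) * formInner g α α x =
      formInner g (interiorMul X (twistedD (flat g X) α)) α x +
        formInner g (twistedD (flat g X) (interiorMul X α)) α x -
          formInner g (lieDeriv X α) α x := by
  rw [eq_sub_iff_add_eq', ← formInner_smul_left g (fun x => g.inner x (X x) (X x)),
    ← formInner_add_left, ← formInner_add_left, funext (interiorMul_twistedD_add g X α)]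

variable [MeasurableSpace M]

theorem integral_formInner_interiorMul_eq_zero {β : Form n M (p + 1)}
    (hβ : ∀ᵐ x ∂riemannianVolume g, formInner g β β x = 0)
    (X : (x : M) → TangentSpace (𝓡 n) x) (α : Form n M p) :
    ∫ x, formInner g (interiorMul X β) α x ∂riemannianVolume g = 0 :=
  integral_eq_zero_of_ae (hβ.mono fun _ hx => formInner_interiorMul_eq_zero hx X α)

theorem IsAdjoint.integral_eq_zero {α : Form n M (p + 1)} {β γ : Form n M p}
    (hβ : IsAdjoint g θ α β) (ae_zero : ∀ᵐ x ∂riemannianVolume g, formInner g β β x = 0)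
    (hγ : IsSmooth γ) : ∫ x, formInner g (twistedD θ γ) α x ∂riemannianVolume g = 0 := by
  rw [hβ.2 γ hγ]
  refine integral_eq_zero_of_ae (ae_zero.mono fun x hx => ?_)
  rw [formInner_comm, formInner_eq_zero_of_self hx, Pi.zero_apply]

variable [CompactSpace M] [BorelSpace M]

theorem integrable_formInner (g : Metric n M) {α β : Form n M p} (hα : IsSmooth α)
    (hβ : IsSmooth β) : Integrable (formInner g α β) (riemannianVolume g) :=
  integrable_of_continuous g (isSmoothFun_formInner g hα hβ).continuous

theorem ae_formInner_self_eq_zero {α : Form n M p} (hα : IsSmooth α)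
    (h : ∫ x, formInner g α α x ∂riemannianVolume g = 0) :
    ∀ᵐ x ∂riemannianVolume g, formInner g α α x = 0 :=
  (integral_eq_zero_iff_of_nonneg (formInner_self_nonneg g α) (integrable_formInner g hα hα)).1 h

theorem IsHarmonic.ae_twistedD_zero {α : Form n M 0} (hθ : IsSmooth θ) (hα : IsHarmonic g θ α) :
    ∀ᵐ x ∂riemannianVolume g, formInner g (twistedD θ α) (twistedD θ α) x = 0 := by
  obtain ⟨smooth_α, adjoint_zero⟩ : IsSmooth α ∧ IsAdjoint g θ (twistedD θ α) fun _ => 0 := hα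
  refine ae_formInner_self_eq_zero (hθ.twistedD smooth_α) ?_
  rw [adjoint_zero.2 α smooth_α]
  simp only [formInner_zero_right, integral_zero]

theorem IsHarmonic.ae_twistedD_succ {α : Form n M (p + 1)} (hθ : IsSmooth θ)
    (hα : IsHarmonic g θ α) :
    (∀ᵐ x ∂riemannianVolume g, formInner g (twistedD θ α) (twistedD θ α) x = 0) ∧
      ∃ β : Form n M p, IsAdjoint g θ α β ∧ ∀ᵐ x ∂riemannianVolume g, formInner g β β x = 0 := by
  obtain ⟨smooth_α, β, η, hβ, hη, laplacian_eq_zero⟩ := hα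
  have sum_eq_zero : ∫ x, formInner g (twistedD θ β) α x ∂riemannianVolume g +
      ∫ x, formInner g η α x ∂riemannianVolume g = 0 := by
    rw [← integral_add (integrable_formInner g (hθ.twistedD hβ.1) smooth_α)
      (integrable_formInner g hη.1 smooth_α)]
    simp only [← formInner_add_left, ← laplacian_eq_zero, formInner_zero_left, integral_zero]
  simp only [formInner_comm g η α, hβ.2 β hβ.1, ← hη.2 α smooth_α] at sum_eq_zero
  obtain ⟨norm_β, norm_dα⟩ := (add_eq_zero_iff_of_nonneg
    (integral_nonneg (formInner_self_nonneg g β))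
    (integral_nonneg (formInner_self_nonneg g (twistedD θ α)))).1 sum_eq_zero
  exact ⟨ae_formInner_self_eq_zero (hθ.twistedD smooth_α) norm_dα, β, hβ,
    ae_formInner_self_eq_zero hβ.1 norm_β⟩

theorem IsHarmonic.integral_norm_mul_eq {α : Form n M p} (hX : IsSmoothField X)
    (hα : IsHarmonic g (flat g X) α) :
    ∫ x, g.inner x (X x) (X x) * formInner g α α x ∂riemannianVolume g =
      -∫ x, formInner g (lieDeriv X α) α x ∂riemannianVolume g := by
  have smooth_flat := hX.flat g
  have smooth_twistedD := smooth_flat.twistedD hα.1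
  have integrable_lieDeriv := integrable_formInner g (hα.1.lieDeriv hX) hα.1
  have integrable_interior := integrable_formInner g (smooth_twistedD.interiorMul hX) hα.1
  cases p with
  | zero =>
    simp only [norm_mul_formInner_zero]
    rw [integral_sub integrable_interior integrable_lieDeriv,
      integral_formInner_interiorMul_eq_zero (hα.ae_twistedD_zero smooth_flat), zero_sub]
  | succ p =>
    obtain ⟨ae_twistedD, β, hβ, ae_β⟩ := hα.ae_twistedD_succ smooth_flat
    have smooth_interior := hα.1.interiorMul hX
    have integrable_twistedD := integrable_formInner g (smooth_flat.twistedD smooth_interior) hα.1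
    simp only [norm_mul_formInner_succ]
    refine (integral_sub (integrable_interior.add integrable_twistedD) integrable_lieDeriv).trans ?_
    rw [integral_add' integrable_interior integrable_twistedD,
      integral_formInner_interiorMul_eq_zero ae_twistedD, hβ.integral_eq_zero ae_β smooth_interior,
      add_zero, zero_sub]

theorem integral_formInner_lieDeriv_self [T2Space M] {α : Form n M p} (hα : IsSmooth α)
    (hX : IsSmoothField X) :
    ∫ x, formInner g (lieDeriv X α) α x ∂riemannianVolume g =
      ∫ x, (gradAction g X α x - 2⁻¹ * (formInner g α α x * divergence g X x))
        ∂riemannianVolume g := by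
  have smooth_norm := isSmoothFun_formInner g hα hα
  have pointwise (x : M) : gradAction g X α x - 2⁻¹ * (formInner g α α x * divergence g X x) =
      formInner g (lieDeriv X α) α x -
        2⁻¹ * (dirDeriv X (formInner g α α) x + formInner g α α x * divergence g X x) := by
    rw [formInner_lieDeriv_self hα hX]
    ring
  simp only [pointwise]
  rw [integral_sub (integrable_formInner g (hα.lieDeriv hX) hα), integral_const_mul,
    integral_dirDeriv_add g hX smooth_norm, mul_zero, sub_zero]
  exact (integrable_of_continuous g ((smooth_norm.continuous_dirDeriv hX).add
    (smooth_norm.continuous.mul (continuous_divergence g hX)))).const_mul _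

theorem IsHarmonic.integral_norm_mul_le [T2Space M] {α : Form n M p} (hX : IsSmoothField X)
    (hα : IsHarmonic g (flat g X) α) :
    ∫ x, g.inner x (X x) (X x) * formInner g α α x ∂riemannianVolume g ≤
      (n + 1) * ∫ x, (gradNorm g X x + |divergence g X x|) * formInner g α α x
        ∂riemannianVolume g := by
  have integrable_bound : Integrable (fun x => (gradNorm g X x + |divergence g X x|) *
      formInner g α α x) (riemannianVolume g) := integrable_of_continuous g
    (((continuous_gradNorm g hX).add (continuous_divergence g hX).abs).mul
      (isSmoothFun_formInner g hα.1 hα.1).continuous)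
  rw [hα.integral_norm_mul_eq hX, integral_formInner_lieDeriv_self hα.1 hX, ← integral_const_mul]
  refine (neg_le_abs _).trans ?_
  rw [← Real.norm_eq_abs]
  exact norm_integral_le_of_norm_le (integrable_bound.const_mul _)
    (.of_forall (abs_gradAction_sub_le hX α))

end Harmonic

end MorseNovikov

end

theorem corollary4p2_general {n p : ℕ} {M : Type*} [TopologicalSpace M]
    [ChartedSpace (EuclideanSpace ℝ (Fin n)) M] [IsManifold (𝓡 n) ∞ M] [CompactSpace M] [T2Space M]
    [MeasurableSpace M] [BorelSpace M] (g : MorseNovikov.Metric n M) {θ : MorseNovikov.Form n M 1}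
    (hθ : MorseNovikov.IsSmooth θ) {X : (x : M) → TangentSpace (𝓡 n) x}
    (hX : ∀ (x : M) (v : TangentSpace (𝓡 n) x), g.inner x (X x) v = θ x (fun _ => v))
    {α : MorseNovikov.Form n M p} (hα : MorseNovikov.IsHarmonic g θ α) :
    ∫ x, g.inner x (X x) (X x) * MorseNovikov.formInner g α α x
        ∂(MorseNovikov.riemannianVolume g) ≤
      (n + 1) * ∫ x, (MorseNovikov.gradNorm g X x + |MorseNovikov.divergence g X x|) *
        MorseNovikov.formInner g α α x ∂(MorseNovikov.riemannianVolume g) := by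
  obtain rfl := MorseNovikov.eq_flat hX
  exact hα.integral_norm_mul_le (.of_flat hθ)

theorem corollary4p2 (n : ℕ) :
    ∃ C : ℝ, ∀ (M : Type*) [TopologicalSpace M] [ChartedSpace (EuclideanSpace ℝ (Fin n)) M]
      [IsManifold (𝓡 n) ∞ M] [CompactSpace M] [T2Space M] [MeasurableSpace M] [BorelSpace M]
      (g : MorseNovikov.Metric n M)
      (θ : MorseNovikov.Form n M 1) (_ : MorseNovikov.IsSmooth θ)
      (_ : ∀ x, MorseNovikov.extDer θ x = 0)
      (X : (x : M) → TangentSpace (𝓡 n) x)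
      (_ : ∀ (x : M) (v : TangentSpace (𝓡 n) x), g.inner x (X x) v = θ x (fun _ => v))
      (p : ℕ) (α : MorseNovikov.Form n M p) (_ : MorseNovikov.IsHarmonic g θ α),
      ∫ x, g.inner x (X x) (X x) * MorseNovikov.formInner g α α x
          ∂(MorseNovikov.riemannianVolume g) ≤
        C * ∫ x, (MorseNovikov.gradNorm g X x + |MorseNovikov.divergence g X x|) *
          MorseNovikov.formInner g α α x ∂(MorseNovikov.riemannianVolume g) :=
  ⟨n + 1, fun _ _ _ _ _ _ _ _ g _ hθ _ _ hX _ _ hα => corollary4p2_general g hθ hX hα⟩
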